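/- Let $B_1^n$ be the closed Euclidean unit ball of $\mathbb{R}^n$ centred at the origin. For a discrete set $P\subseteq\mathbb{R}^n$ put $$\vartheta(P)=\limsup_{r\to\infty}\sum_{p\in P}\frac{\operatorname{vol}\big([-r,r]^n\cap(B_1^n+p)\big)}{\operatorname{vol}([-r,r]^n)},\qquad \mu(P)=\sup_{x\in\mathbb{R}^n}\big|\{p\in P: x\in B_1^n+p\}\big|$$ (the covering density and the covering multiplicity of $P$). The equation $\ln(2x/\mathrm{e})=1/(2x)$ has a unique positive real root $\xi=1.79556\ldots$, and there are functions $\varepsilon_1(n),\varepsilon_2(n)\to0$ as $n\to\infty$ such that for every $n\ge2$ there is a discrete set $P\subseteq\mathbb{R}^n$ with $P+B_1^n=\mathbb{R}^n$, $$\vartheta(P)\le\Big(\tfrac12+\varepsilon_1(n)\Big)n\ln n\qquad\text{and}\qquad \mu(P)\le\big(\xi+\varepsilon_2(n)\big)n\ln n .$$ -/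

import Mathlib

open Filter Topology MeasureTheory
open scoped ENNReal Pointwise

noncomputable section

/-- A discrete set `P` is a `K`-covering of `A` if `A ⊆ P + K`. -/
structure IsCovering {n : ℕ} (K P A : Set (EuclideanSpace ℝ (Fin n))) : Prop where
  isDiscrete : IsDiscrete P
  subset_add : A ⊆ P + K

/-- The cube `[-r, r]^n`. -/
def cube (n : ℕ) (r : ℝ) : Set (EuclideanSpace ℝ (Fin n)) :=
  {x | ∀ i, x i ∈ Set.Icc (-r) r}

/-- Covering density of `P` over a set `A` of finite measure:
the sum over `p ∈ P` of `vol (A ∩ (K + p)) / vol A`, in `[0, ∞]`. -/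
def coveringDensityOn {n : ℕ} (K P A : Set (EuclideanSpace ℝ (Fin n))) : ℝ≥0∞ :=
  ∑' p : P, volume (A ∩ ((p : EuclideanSpace ℝ (Fin n)) +ᵥ K)) / volume A

/-- Covering multiplicity of a point: the number of `p ∈ P` with `x ∈ K + p`. -/
def coveringMultiplicityAt {n : ℕ} (K P : Set (EuclideanSpace ℝ (Fin n)))
    (x : EuclideanSpace ℝ (Fin n)) : ℕ∞ :=
  {p ∈ P | x ∈ p +ᵥ K}.encard

/-- Covering multiplicity of `P` over `A`. -/
def coveringMultiplicityOn {n : ℕ} (K P A : Set (EuclideanSpace ℝ (Fin n))) : ℕ∞ :=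
  ⨆ x ∈ A, coveringMultiplicityAt K P x

/-- `K`-covering density of `P` over the whole space. -/
def coveringDensity {n : ℕ} (K P : Set (EuclideanSpace ℝ (Fin n))) : ℝ≥0∞ :=
  limsup (fun r : ℝ => coveringDensityOn K P (cube n r)) atTop

/-- `K`-covering multiplicity of `P` over the whole space. -/
def coveringMultiplicity {n : ℕ} (K P : Set (EuclideanSpace ℝ (Fin n))) : ℕ∞ :=
  ⨆ r : ℝ, coveringMultiplicityOn K P (cube n r)

/-- The closed Euclidean unit ball centred at the origin. -/
def unitBall (n : ℕ) : Set (EuclideanSpace ℝ (Fin n)) :=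
  Metric.closedBall 0 1

end

/-!
The covering is a random set that is periodic under a lattice `Λ`: the union of the cosets of `m`
independent uniform points of a fundamental domain `D`. Write `β = vol B / vol D`, so that the
density is at most `m β`, which is chosen close to `(1 / 2) n log n`.

The lattice is maximal among those with minimal norm at least `4`. Maximality under adjoining
points `x` with `3 x ∈ Λ` bounds its covering radius by `8` (`Maximal.exists_near`), so
`8⁻ⁿ ≤ β ≤ 1`, and modulo `Λ` there are nets of width `r` with at most `(16 / r) ^ n` points
(`IsPeriod.exists_net`). Hence plain union bounds over one period lose only factors `exp (O(n))`,
negligible against `n ^ n = exp (n log n)`.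

*Covering.* Take a net of width `ε` slightly below `1 / √n`, which has `n ^ (n / 2 + o(n))` points.
Suppose that `z` in `B (y, ε)` is not covered, for a net point `y`. Then all points of the set
within `ρ` of `y`, where `ρ ^ 2 = 1 - ε ^ 2 - 2 ε τ`, are displaced from `y` by more than `τ` in the
direction opposite to `z - y`, so their sum is large and correlates with one of `exp (O(n))`
directions `w` (`IsPeriod.exists_one_le_prod_coverWeight`). A linear functional on a ball in `ℝⁿ`
is of size `1 / √n`, so for `τ` of order `log n / √n` an exponential moment
(`lintegral_exp_inner_le`) shows that this has probability at most about
`exp (- m β ρ ^ n)`, that is `exp (- m β (1 - o(1)))`, since `ρ ^ n → 1`.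
The density `(1 / 2 + o(1)) n log n` suffices to beat the net.

*Multiplicity.* With a net of width `1 / (n log n)`, of `n ^ (n + o(n))` points, it remains to bound
the probability that a ball of radius `1 + o(1 / n)` contains `x n log n` points. The Chernoff bound
with base `2 x` gives `exp (- n log n (1 / 2 - x + x log (2 x)))`, and `x = ξ` is where this
exponent reaches `- n log n`.

The random choice is carried out by conditional expectations (`exists_sum_mul_prod_le`), so that
only integrals over `D` of periodic functions are needed.
-/

/-! ### Lattices with bounded covering radius -/

/-- Euclidean `n`-space. -/
abbrev Euc (n : ℕ) := EuclideanSpace ℝ (Fin n)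

/-- The submodule `Λ` has minimal norm at least `d`. -/
def MinNormGE {n : ℕ} (d : ℝ) (Λ : Submodule ℤ (Euc n)) : Prop :=
  ∀ l ∈ Λ, l ≠ 0 → d ≤ ‖l‖

/-- The lattice `d ℤⁿ`. -/
def cubicLattice (n : ℕ) (d : ℝ) : Submodule ℤ (Euc n) where
  carrier := {x | ∀ i, ∃ k : ℤ, x i = d * k}
  zero_mem' := fun i => ⟨0, by simp⟩
  add_mem' := by
    intro a b ha hb i
    obtain ⟨k, hk⟩ := ha i
    obtain ⟨j, hj⟩ := hb i
    exact ⟨k + j, by simp [hk, hj, mul_add]⟩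
  smul_mem' := by
    intro c x hx i
    obtain ⟨k, hk⟩ := hx i
    refine ⟨c * k, ?_⟩
    have : (c • x) i = c * x i := by simp
    rw [this, hk]; push_cast; ring

lemma minNormGE_cubicLattice (n : ℕ) {d : ℝ} (hd : 0 < d) : MinNormGE d (cubicLattice n d) := by
  intro l hl hne
  obtain ⟨i, hi⟩ : ∃ i, l i ≠ 0 := by
    by_contra! h
    exact hne (by ext i; simpa using h i)
  obtain ⟨k, hk⟩ := hl i
  have hk0 : k ≠ 0 := by
    rintro rfl
    exact hi (by simpa using hk)
  have h1 : (1 : ℝ) ≤ |(k : ℝ)| := by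
    exact_mod_cast Int.one_le_abs hk0
  calc d ≤ d * |(k : ℝ)| := le_mul_of_one_le_right hd.le h1
    _ = ‖l i‖ := by rw [hk, Real.norm_eq_abs, abs_mul, abs_of_pos hd]
    _ ≤ ‖l‖ := PiLp.norm_apply_le l i

lemma exists_cubicLattice_near (n : ℕ) {d : ℝ} (hd : 0 < d) (x : Euc n) :
    ∃ l ∈ cubicLattice n d, ‖x - l‖ ≤ n * d := by
  refine ⟨WithLp.toLp 2 fun i => d * ⌊x i / d⌋, fun i => ⟨⌊x i / d⌋, rfl⟩, ?_⟩
  have key : ∀ i, |x i - d * ⌊x i / d⌋| ≤ d := by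
    intro i
    have e : x i - d * ⌊x i / d⌋ = d * Int.fract (x i / d) := by
      rw [Int.fract]; field_simp
    rw [e, abs_of_nonneg (mul_nonneg hd.le (Int.fract_nonneg _))]
    exact mul_le_of_le_one_right hd.le (Int.fract_lt_one _).le
  refine abs_le_of_sq_le_sq' ?_ (by positivity) |>.2
  rw [EuclideanSpace.norm_sq_eq]
  calc ∑ i, ‖(x - WithLp.toLp 2 fun i => d * (⌊x i / d⌋ : ℝ)) i‖ ^ 2 ≤ ∑ _i : Fin n, d ^ 2 := by
        refine Finset.sum_le_sum fun i _ => ?_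
        exact pow_le_pow_left₀ (norm_nonneg _) (by simpa using key i) 2
    _ = n * d ^ 2 := by simp
    _ ≤ (n * d) ^ 2 := by
        rw [mul_pow]
        refine mul_le_mul_of_nonneg_right ?_ (by positivity)
        exact_mod_cast Nat.le_self_pow (by norm_num) n

/-- Zorn's lemma: the cubic lattice extends to a submodule that is maximal among those with the
same lower bound on the minimal norm. -/
lemma exists_maximal_minNormGE (n : ℕ) {d : ℝ} (hd : 0 < d) :
    ∃ Λ : Submodule ℤ (Euc n), cubicLattice n d ≤ Λ ∧ Maximal (MinNormGE d) Λ := by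
  refine zorn_le_nonempty₀ {Λ : Submodule ℤ (Euc n) | MinNormGE d Λ} ?_ _
    (minNormGE_cubicLattice n hd)
  intro c hc hchain y hy
  refine ⟨sSup c, ?_, fun z hz => le_sSup hz⟩
  intro l hl hne
  rw [Submodule.mem_sSup_of_directed ⟨y, hy⟩ hchain.directedOn] at hl
  obtain ⟨Λ, hΛ, hl⟩ := hl
  exact hc hΛ l hl hne

/-- A third of a lattice vector lies close to a maximal `Λ`: otherwise it could be adjoined, the
cosets `Λ ± x` being far from the origin. -/
lemma Maximal.exists_near_of_three_smul_mem {n : ℕ} {d : ℝ} (hd : 0 < d)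
    {Λ : Submodule ℤ (Euc n)} (hΛ : Maximal (MinNormGE d) Λ) {x : Euc n}
    (hx : (3 : ℤ) • x ∈ Λ) : ∃ l ∈ Λ, ‖x - l‖ < d := by
  by_contra! h
  have hneg : ∀ l ∈ Λ, d ≤ ‖l + x‖ := fun l hl => by
    have := h (-l) (Λ.neg_mem hl)
    rwa [sub_neg_eq_add, add_comm] at this
  have hle : Λ ⊔ Submodule.span ℤ {x} ≤ Λ := by
    refine hΛ.2 ?_ le_sup_left
    intro z hz hne
    obtain ⟨l, hl, w, hw, rfl⟩ := Submodule.mem_sup.1 hz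
    obtain ⟨k, rfl⟩ := Submodule.mem_span_singleton.1 hw
    obtain ⟨j, r, hr, rfl⟩ : ∃ j r : ℤ, (r = 0 ∨ r = 1 ∨ r = -1) ∧ k = 3 * j + r := by
      have h3 : k % 3 = 0 ∨ k % 3 = 1 ∨ k % 3 = 2 := by omega
      rcases h3 with h3 | h3 | h3
      · exact ⟨k / 3, 0, by simp, by omega⟩
      · exact ⟨k / 3, 1, by simp, by omega⟩
      · exact ⟨k / 3 + 1, -1, by simp, by omega⟩
    have e : l + (3 * j + r) • x = (l + j • (3 : ℤ) • x) + r • x := by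
      rw [add_smul, mul_comm, mul_smul, add_assoc]
    have hl' : l + j • (3 : ℤ) • x ∈ Λ := Λ.add_mem hl (Λ.smul_mem _ hx)
    rw [e] at hne ⊢
    rcases hr with rfl | rfl | rfl
    · rw [zero_smul, add_zero] at hne ⊢
      exact hΛ.1 _ hl' hne
    · rw [one_smul]
      exact hneg _ hl'
    · rw [neg_smul, one_smul, ← norm_neg]
      have := h _ hl'
      rwa [neg_add, neg_neg, add_comm, ← sub_eq_add_neg]
  have hxΛ : x ∈ Λ := hle (Submodule.mem_sup_right (Submodule.mem_span_singleton_self x))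
  have := h x hxΛ
  simp only [sub_self, norm_zero] at this
  linarith

/-- A maximal `Λ` has covering radius at most `2 d`: a covering radius `C` can be improved to
`d + C / 3`, and the fixed point of this improvement is `3 d / 2`. -/
lemma Maximal.exists_near {n : ℕ} {d : ℝ} (hd : 0 < d)
    {Λ : Submodule ℤ (Euc n)} (hc : cubicLattice n d ≤ Λ) (hΛ : Maximal (MinNormGE d) Λ)
    (x : Euc n) : ∃ l ∈ Λ, ‖x - l‖ ≤ 2 * d := by
  have key : ∀ k : ℕ, ∀ x : Euc n, ∃ l ∈ Λ, ‖x - l‖ ≤ n * d * (1 / 3) ^ k + 3 / 2 * d := by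
    intro k
    induction k with
    | zero =>
      intro x
      obtain ⟨l, hl, h⟩ := exists_cubicLattice_near n hd x
      exact ⟨l, hc hl, by simp only [pow_zero]; linarith⟩
    | succ k ih =>
      intro x
      obtain ⟨l, hl, h⟩ := ih ((3 : ℝ) • x)
      have h3 : (3 : ℤ) • ((1 / 3 : ℝ) • l) = l := by
        rw [← Int.cast_smul_eq_zsmul ℝ, smul_smul]; norm_num
      obtain ⟨l', hl', h'⟩ := hΛ.exists_near_of_three_smul_mem hd
        (x := (1 / 3 : ℝ) • l) (by rwa [h3])
      refine ⟨l', hl', ?_⟩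
      have e : x - l' = (1 / 3 : ℝ) • ((3 : ℝ) • x - l) + ((1 / 3 : ℝ) • l - l') := by
        rw [smul_sub, smul_smul]; norm_num
      have hn : ‖(1 / 3 : ℝ) • ((3 : ℝ) • x - l)‖ = 1 / 3 * ‖(3 : ℝ) • x - l‖ := by
        rw [norm_smul]; norm_num
      calc ‖x - l'‖ ≤ 1 / 3 * ‖(3 : ℝ) • x - l‖ + ‖(1 / 3 : ℝ) • l - l'‖ := by
            rw [e, ← hn]; exact norm_add_le _ _
        _ ≤ _ := by rw [pow_succ]; linarith
  have hlim : Tendsto (fun k : ℕ => n * d * (1 / 3 : ℝ) ^ k) atTop (𝓝 (n * d * 0)) :=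
    (tendsto_pow_atTop_nhds_zero_of_lt_one (by norm_num) (by norm_num)).const_mul _
  rw [mul_zero] at hlim
  obtain ⟨k, hk⟩ := (hlim.eventually (gt_mem_nhds (show 0 < d / 2 by positivity))).exists
  obtain ⟨l, hl, h⟩ := key k x
  exact ⟨l, hl, by linarith⟩

/-- A full-rank lattice `Λ` with a bounded measurable fundamental domain `D`, whose nonzero
vectors have norm at least `d` and whose covering radius is at most `2 d`. -/
structure IsPeriod {n : ℕ} (d : ℝ) (Λ : Submodule ℤ (Euc n)) (D : Set (Euc n)) : Prop where
  pos : 0 < d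
  countable : Countable Λ
  measurableSet : MeasurableSet D
  isBounded : Bornology.IsBounded D
  existsUnique : ∀ x, ∃! l : Λ, l +ᵥ x ∈ D
  minNorm : MinNormGE d Λ
  exists_near : ∀ x, ∃ l ∈ Λ, ‖x - l‖ ≤ 2 * d

theorem exists_isPeriod (n : ℕ) {d : ℝ} (hd : 0 < d) :
    ∃ (Λ : Submodule ℤ (Euc n)) (D : Set (Euc n)), IsPeriod d Λ D := by
  obtain ⟨Λ, hc, hΛ⟩ := exists_maximal_minNormGE n hd
  have hdisc : DiscreteTopology Λ := by
    refine DiscreteTopology.of_forall_le_dist hd ?_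
    intro x y hxy
    have : (x : Euc n) - y ≠ 0 := by
      rw [sub_ne_zero]; exact fun h => hxy (Subtype.ext h)
    have := hΛ.1 _ (Λ.sub_mem x.2 y.2) this
    rwa [Subtype.dist_eq, dist_eq_norm]
  have hspan : Submodule.span ℝ (Λ : Set (Euc n)) = ⊤ := by
    rw [eq_top_iff, ← (EuclideanSpace.basisFun (Fin n) ℝ).toBasis.span_eq, Submodule.span_le]
    rintro _ ⟨i, rfl⟩
    have hmem : d • EuclideanSpace.single i (1 : ℝ) ∈ Λ := by
      refine hc fun j => ?_
      by_cases h : j = i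
      · exact ⟨1, by simp [h]⟩
      · exact ⟨0, by simp [h]⟩
    have := Submodule.smul_mem _ d⁻¹ (Submodule.subset_span (R := ℝ) hmem)
    rw [smul_smul, inv_mul_cancel₀ hd.ne', one_smul] at this
    simpa using this
  have : IsZLattice ℝ Λ := ⟨hspan⟩
  let b := (Module.Free.chooseBasis ℤ Λ).ofZLatticeBasis ℝ Λ
  have hb : Submodule.span ℤ (Set.range b) = Λ := Module.Basis.ofZLatticeBasis_span ℝ Λ _
  refine ⟨Λ, ZSpan.fundamentalDomain b, hd, inferInstance,
    ZSpan.fundamentalDomain_measurableSet b, ZSpan.fundamentalDomain_isBounded b, ?_, hΛ.1,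
    hΛ.exists_near hd hc⟩
  intro x
  have := ZSpan.exist_unique_vadd_mem_fundamentalDomain b x
  rwa [hb] at this

/-! ### Packings and nets modulo a lattice -/

instance vaddInvariantMeasure_volume {n : ℕ} (Λ : Submodule ℤ (Euc n)) :
    VAddInvariantMeasure Λ (Euc n) (volume : Measure (Euc n)) where
  measure_preimage_vadd c _ _ := measure_preimage_add volume (c : Euc n) _

namespace IsPeriod

variable {n : ℕ} {d : ℝ} {Λ : Submodule ℤ (Euc n)} {D : Set (Euc n)}

lemma isAddFundamentalDomain (h : IsPeriod d Λ D) :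
    IsAddFundamentalDomain Λ D (volume : Measure (Euc n)) :=
  .mk' h.measurableSet.nullMeasurableSet h.existsUnique

lemma eq_zero (h : IsPeriod d Λ D) {l : Euc n} (hl : l ∈ Λ) (hd : ‖l‖ < d) : l = 0 := by
  by_contra hne
  exact absurd (h.minNorm l hl hne) (not_le.2 hd)

lemma volume_le (h : IsPeriod d Λ D) :
    volume D ≤ volume (Metric.closedBall (0 : Euc n) (2 * d)) := by
  have := h.countable
  rw [h.isAddFundamentalDomain.measure_eq_tsum (Metric.closedBall 0 (2 * d))]
  refine le_trans (measure_mono fun x hx => ?_) (measure_iUnion_le _)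
  obtain ⟨l, hl, hxl⟩ := h.exists_near x
  refine Set.mem_iUnion.2 ⟨⟨l, hl⟩, ?_, hx⟩
  refine Set.mem_vadd_set.2 ⟨x - l, by simpa using hxl, ?_⟩
  simp [Submodule.vadd_def]

lemma volume_ne_top (h : IsPeriod d Λ D) : volume D ≠ ∞ :=
  h.isBounded.measure_lt_top.ne

/-- Balls of radius `r / 2` around a set of points that is `r`-separated modulo `Λ` pack into
a fundamental domain. -/
lemma card_mul_volume_le (h : IsPeriod d Λ D) {r : ℝ} (hr : r < d) {Y : Finset (Euc n)}
    (hY : ∀ y ∈ Y, ∀ y' ∈ Y, y ≠ y' → ∀ l ∈ Λ, r < ‖y - (l + y')‖) :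
    Y.card * volume (Metric.closedBall (0 : Euc n) (r / 2)) ≤ volume D := by
  have := h.countable
  have hdisj : ∀ y ∈ Y, ∀ y' ∈ Y, ∀ l ∈ Λ, ∀ z, ‖z - y‖ ≤ r / 2 → ‖z - (l + y')‖ ≤ r / 2 →
      y = y' ∧ l = 0 := by
    intro y hy y' hy' l hl z h1 h2
    have h3 : ‖y - (l + y')‖ ≤ r := by
      have : y - (l + y') = (z - (l + y')) - (z - y) := by abel
      rw [this]
      exact (norm_sub_le _ _).trans (by linarith)
    by_cases e : y = y'
    · subst e
      refine ⟨rfl, h.eq_zero hl ?_⟩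
      have : y - (l + y) = -l := by abel
      rw [this, norm_neg] at h3
      linarith
    · exact absurd (hY y hy y' hy' e l hl) (not_lt.2 h3)
  have hvol : volume (⋃ y ∈ Y, Metric.closedBall y (r / 2)) =
      Y.card * volume (Metric.closedBall (0 : Euc n) (r / 2)) := by
    rw [measure_biUnion_finset]
    · simp [Measure.addHaar_closedBall_center]
    · intro y hy y' hy' hne
      refine Set.disjoint_left.2 fun z hz hz' => hne ?_
      refine (hdisj y hy y' hy' 0 Λ.zero_mem z ?_ ?_).1
      · simpa [dist_eq_norm] using hz
      · simpa [dist_eq_norm] using hz'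
    · exact fun _ _ => measurableSet_closedBall
  rw [← hvol]
  refine h.isAddFundamentalDomain.measure_le_of_pairwise_disjoint
    (Finset.measurableSet_biUnion _ fun _ _ => measurableSet_closedBall).nullMeasurableSet ?_
  intro l l' hne
  refine Disjoint.aedisjoint (Set.disjoint_left.2 ?_)
  rintro z ⟨hz, -⟩ ⟨hz', -⟩
  refine hne ?_
  obtain ⟨a, ha, rfl⟩ := Set.mem_vadd_set.1 hz
  obtain ⟨a', ha', e⟩ := Set.mem_vadd_set.1 hz'
  simp only [Set.mem_iUnion, Metric.mem_closedBall, dist_eq_norm, exists_prop] at ha ha'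
  obtain ⟨y, hy, hay⟩ := ha
  obtain ⟨y', hy', hay'⟩ := ha'
  have e2 : (l' : Euc n) + a' = l + a := by simpa [Submodule.vadd_def] using e
  have := (hdisj y hy y' hy' (l' - l) (Λ.sub_mem l'.2 l.2) a hay (by
    have e3 : a - ((l' : Euc n) - l + y') = a' - y' := by
      have : a = l' + a' - l := by rw [e2]; abel
      rw [this]; abel
    rwa [e3])).2
  exact (Subtype.ext (sub_eq_zero.1 this)).symm

/-- A maximal `r`-separated set modulo `Λ` is an `r`-net modulo `Λ`; it exists because the packing
bound limits its size. -/
lemma exists_net_aux (h : IsPeriod d Λ D) {r : ℝ} (hr0 : 0 < r) (hr : r < d) :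
    ∃ Y : Finset (Euc n), (∀ x, ∃ y ∈ Y, ∃ l ∈ Λ, ‖x - (l + y)‖ ≤ r) ∧
      Y.card * volume (Metric.closedBall (0 : Euc n) (r / 2)) ≤ volume D := by
  classical
  by_contra! hcon
  have key : ∀ k : ℕ, ∃ Y : Finset (Euc n), Y.card = k ∧
      ∀ y ∈ Y, ∀ y' ∈ Y, y ≠ y' → ∀ l ∈ Λ, r < ‖y - (l + y')‖ := by
    intro k
    induction k with
    | zero => exact ⟨∅, by simp⟩
    | succ k ih =>
      obtain ⟨Y, hk, hY⟩ := ih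
      obtain ⟨x, hx⟩ : ∃ x, ∀ y ∈ Y, ∀ l ∈ Λ, r < ‖x - (l + y)‖ := by
        by_contra! hnet
        exact absurd (h.card_mul_volume_le hr hY) (not_le.2 (hcon Y hnet))
      have hxY : x ∉ Y := fun hxY => by
        have := hx x hxY 0 Λ.zero_mem
        simp only [zero_add, sub_self, norm_zero] at this
        linarith
      refine ⟨insert x Y, by rw [Finset.card_insert_of_notMem hxY, hk], ?_⟩
      intro y hy y' hy' hne l hl
      rcases Finset.mem_insert.1 hy with e | hy <;>
        rcases Finset.mem_insert.1 hy' with e' | hy'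
      · exact absurd (e.trans e'.symm) hne
      · exact e ▸ hx y' hy' l hl
      · have := hx y hy (-l) (Λ.neg_mem hl)
        have e2 : y - (l + y') = -(x - (-l + y)) := by rw [e']; abel
        rwa [e2, norm_neg]
      · exact hY y hy y' hy' hne l hl
  have hpos : volume (Metric.closedBall (0 : Euc n) (r / 2)) ≠ 0 :=
    (Metric.measure_closedBall_pos volume _ (by positivity)).ne'
  obtain ⟨k, hk⟩ := ENNReal.exists_nat_mul_gt hpos h.volume_ne_top
  obtain ⟨Y, rfl, hY⟩ := key k
  exact absurd (h.card_mul_volume_le hr hY) (not_le.2 hk)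

lemma volume_closedBall_eq (n : ℕ) (x : Euc n) {r : ℝ} (hr : 0 ≤ r) :
    volume (Metric.closedBall x r) = ENNReal.ofReal (r ^ n) * volume (unitBall n) := by
  rw [Measure.addHaar_closedBall' _ _ hr, unitBall]
  simp

lemma volume_unitBall_ne_zero (n : ℕ) : volume (unitBall n) ≠ 0 :=
  (Metric.measure_closedBall_pos volume _ one_pos).ne'

lemma volume_unitBall_ne_top (n : ℕ) : volume (unitBall n) ≠ ∞ :=
  measure_closedBall_lt_top.ne

/-- The size of the net in terms of `n` only; this is where the covering radius of `Λ`, hence the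
bound `vol D ≤ (2 d) ^ n vol B`, is used. -/
lemma exists_net (h : IsPeriod d Λ D) {r : ℝ} (hr0 : 0 < r) (hr : r < d) :
    ∃ Y : Finset (Euc n), (∀ x, ∃ y ∈ Y, ∃ l ∈ Λ, ‖x - (l + y)‖ ≤ r) ∧
      (Y.card : ℝ) ≤ (4 * d / r) ^ n := by
  obtain ⟨Y, hY, hc⟩ := h.exists_net_aux hr0 hr
  refine ⟨Y, hY, ?_⟩
  have hd := h.pos
  replace hc := hc.trans h.volume_le
  rw [volume_closedBall_eq n _ (by positivity), volume_closedBall_eq n _ (by positivity),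
    ← mul_assoc, ENNReal.mul_le_mul_iff_left (volume_unitBall_ne_zero n)
    (volume_unitBall_ne_top n), ← ENNReal.ofReal_natCast, ← ENNReal.ofReal_mul (by positivity),
    ENNReal.ofReal_le_ofReal_iff (by positivity)] at hc
  have e : (2 * d) ^ n = (4 * d / r) ^ n * (r / 2) ^ n := by
    rw [← mul_pow]; congr 1; field_simp; norm_num
  rw [e] at hc
  exact le_of_mul_le_mul_right hc (by positivity)

lemma volume_unitBall_le (h : IsPeriod d Λ D) (hd : 2 < d) : volume (unitBall n) ≤ volume D := by
  have := h.card_mul_volume_le hd (Y := {0}) (by simp)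
  simpa [unitBall] using this

end IsPeriod

/-! ### Coverings invariant under a lattice -/

lemma volume_cube (n : ℕ) {r : ℝ} (hr : 0 ≤ r) :
    volume (cube n r) = ENNReal.ofReal ((2 * r) ^ n) := by
  have : cube n r = (WithLp.ofLp : Euc n → (Fin n → ℝ)) ⁻¹'
      Set.Icc (fun _ => -r) (fun _ => r) := by
    ext x; simp [cube, Pi.le_def, forall_and]
  rw [this, (PiLp.volume_preserving_ofLp (Fin n)).measure_preimage
    measurableSet_Icc.nullMeasurableSet, Real.volume_Icc_pi]
  simp only [sub_neg_eq_add, Finset.prod_const, Finset.card_univ, Fintype.card_fin]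
  rw [← two_mul, ENNReal.ofReal_pow (by positivity)]

/-- The union of the cosets `Λ + x i`. -/
def periodicSet {n : ℕ} {ι : Type*} (Λ : Submodule ℤ (Euc n)) (x : ι → Euc n) : Set (Euc n) :=
  {p | ∃ i, ∃ l ∈ Λ, p = l + x i}

namespace IsPeriod

variable {n : ℕ} {d : ℝ} {Λ : Submodule ℤ (Euc n)} {D : Set (Euc n)}

/-- Each coset of `Λ` contributes at most one ball to the multiplicity at a point. -/
lemma coveringMultiplicityAt_le (h : IsPeriod d Λ D) (hd : 2 < d) {ι : Type*} [Fintype ι]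
    (x : ι → Euc n) (z : Euc n) (s : Finset ι)
    (hs : ∀ i, (∃ l ∈ Λ, ‖z - (l + x i)‖ ≤ 1) → i ∈ s) :
    coveringMultiplicityAt (unitBall n) (periodicSet Λ x) z ≤ s.card := by
  have hmem : ∀ p ∈ {p ∈ periodicSet Λ x | z ∈ p +ᵥ unitBall n},
      ∃ i, ∃ l ∈ Λ, p = l + x i ∧ ‖z - (l + x i)‖ ≤ 1 := by
    rintro p ⟨⟨i, l, hl, rfl⟩, hz⟩
    refine ⟨i, l, hl, rfl, ?_⟩
    obtain ⟨b, hb, rfl⟩ := Set.mem_vadd_set.1 hz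
    simpa [unitBall] using hb
  rcases isEmpty_or_nonempty ι with hι | hι
  · have : {p ∈ periodicSet Λ x | z ∈ p +ᵥ unitBall n} = ∅ :=
      Set.eq_empty_of_forall_notMem fun p hp => hι.elim (hmem p hp).choose
    rw [coveringMultiplicityAt, this]
    simp
  choose! i l hl e hn using hmem
  rw [coveringMultiplicityAt, ← Set.encard_coe_eq_coe_finsetCard]
  refine Set.encard_le_encard_of_injOn (f := i) (fun p hp => hs _ ⟨l p, hl p hp, hn p hp⟩) ?_
  intro p hp q hq hpq
  have h1 := hn p hp
  have h2 := hn q hq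
  rw [← hpq] at h2
  have h3 : l p - l q = 0 := by
    refine h.eq_zero (Λ.sub_mem (hl p hp) (hl q hq)) ?_
    have : l p - l q = (z - (l q + x (i p))) - (z - (l p + x (i p))) := by abel
    rw [this]
    exact (norm_sub_le _ _).trans_lt (by linarith)
  rw [e p hp, e q hq, ← hpq, sub_eq_zero.1 h3]

lemma isDiscrete_periodicSet (h : IsPeriod d Λ D) (hd : 2 < d) {ι : Type*} [Fintype ι]
    (x : ι → Euc n) : IsDiscrete (periodicSet Λ x) := by
  rw [isDiscrete_iff_nhdsWithin]
  intro p hp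
  have hfin : {q ∈ periodicSet Λ x | p ∈ q +ᵥ unitBall n}.Finite := by
    rw [← Set.encard_lt_top_iff]
    exact (h.coveringMultiplicityAt_le hd x p Finset.univ (by simp)).trans_lt (by simp)
  have hpF : p ∈ {q ∈ periodicSet Λ x | p ∈ q +ᵥ unitBall n} :=
    ⟨hp, Set.mem_vadd_set.2 ⟨0, by simp [unitBall], by simp⟩⟩
  rw [← isDiscrete_iff_nhdsWithin.1 hfin.isDiscrete p hpF]
  refine nhdsWithin_eq_nhdsWithin' (Metric.ball_mem_nhds p one_pos) ?_
  ext q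
  constructor
  · rintro ⟨hq, hb⟩
    refine ⟨⟨hq, Set.mem_vadd_set.2 ⟨p - q, ?_, by simp⟩⟩, hb⟩
    rw [Metric.mem_ball, dist_comm, dist_eq_norm] at hb
    simpa [unitBall] using hb.le
  · rintro ⟨⟨hq, -⟩, hb⟩
    exact ⟨hq, hb⟩

/-- Translates `l + C` meeting the cube of radius `r` are counted by the disjoint translates
`l + D`, which lie in a slightly larger cube. -/
lemma tsum_volume_inter_mul_le (h : IsPeriod d Λ D) {C : Set (Euc n)}
    (hC : Bornology.IsBounded C) : ∃ s : ℝ, 0 ≤ s ∧ ∀ r : ℝ, 0 ≤ r →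
      (∑' l : Λ, volume (cube n r ∩ (l +ᵥ C))) * volume D
        ≤ volume C * ENNReal.ofReal ((2 * (r + s)) ^ n) := by
  have := h.countable
  obtain ⟨R, hR0, hR⟩ := (hC.union h.isBounded).exists_pos_norm_le
  refine ⟨2 * R, by positivity, fun r hr => ?_⟩
  rw [← volume_cube n (by positivity), ← ENNReal.tsum_mul_right,
    h.isAddFundamentalDomain.measure_eq_tsum' (cube n (r + 2 * R)), ← ENNReal.tsum_mul_left]
  refine ENNReal.tsum_le_tsum fun l => ?_
  rcases (cube n r ∩ (l +ᵥ C)).eq_empty_or_nonempty with he | ⟨a, ha, hal⟩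
  · simp [he]
  obtain ⟨c, hc, rfl⟩ := Set.mem_vadd_set.1 hal
  have hsub : l +ᵥ D ⊆ cube n (r + 2 * R) := by
    rintro _ ⟨y, hy, rfl⟩ i
    have h1 := ha i
    have h2 : |c i| ≤ R := (PiLp.norm_apply_le c i).trans (hR c (Or.inl hc))
    have h3 : |y i| ≤ R := (PiLp.norm_apply_le y i).trans (hR y (Or.inr hy))
    simp only [Submodule.vadd_def, vadd_eq_add, PiLp.add_apply, Set.mem_Icc] at h1 ⊢
    rw [abs_le] at h2 h3
    constructor <;> linarith
  rw [Set.inter_eq_right.2 hsub]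
  refine mul_le_mul' ?_ (le_of_eq ?_)
  · refine (measure_mono Set.inter_subset_right).trans (le_of_eq ?_)
    exact measure_vadd _ _ _
  · exact (measure_vadd _ _ _).symm

/-- Every coset of `Λ` contributes at most `vol B / vol D` to the covering density. -/
theorem coveringDensity_le (h : IsPeriod d Λ D) {ι : Type*} [Fintype ι] (x : ι → Euc n) :
    coveringDensity (unitBall n) (periodicSet Λ x)
      ≤ Fintype.card ι * (volume (unitBall n) / volume D) := by
  classical
  have := h.countable
  have hD0 : volume D ≠ 0 := h.isAddFundamentalDomain.measure_ne_zero (NeZero.ne volume)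
  have hb : ∀ i, Bornology.IsBounded (x i +ᵥ unitBall n) := fun i => by
    rw [unitBall, Metric.vadd_closedBall]; exact Metric.isBounded_closedBall
  choose s hs0 hs using fun i => h.tsum_volume_inter_mul_le (hb i)
  have hlim : Tendsto (fun r : ℝ => ∑ i, volume (unitBall n) / volume D *
      ENNReal.ofReal (((r + s i) / r) ^ n)) atTop
      (𝓝 (∑ _i : ι, volume (unitBall n) / volume D * ENNReal.ofReal (1 ^ n))) := by
    refine tendsto_finsetSum _ fun i _ => ?_
    refine ENNReal.Tendsto.const_mul ?_ (Or.inl (by simp))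
    refine ENNReal.tendsto_ofReal (Tendsto.pow ?_ n)
    have : Tendsto (fun r : ℝ => 1 + s i / r) atTop (𝓝 (1 + 0)) :=
      tendsto_const_nhds.add (tendsto_const_nhds.div_atTop tendsto_id)
    rw [add_zero] at this
    refine this.congr' ?_
    filter_upwards [eventually_gt_atTop 0] with r hr
    field_simp
  have hle : ∀ᶠ r : ℝ in atTop, coveringDensityOn (unitBall n) (periodicSet Λ x) (cube n r) ≤
      ∑ i, volume (unitBall n) / volume D * ENNReal.ofReal (((r + s i) / r) ^ n) := by
    filter_upwards [eventually_gt_atTop 0] with r hr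
    have hsec : ∀ p : periodicSet Λ x, ∃ q : ι × Λ, (p : Euc n) = q.2 + x q.1 := by
      rintro ⟨p, i, l, hl, rfl⟩
      exact ⟨(i, ⟨l, hl⟩), rfl⟩
    choose q hq using hsec
    have hinj : Function.Injective q := fun a b hab => Subtype.ext (by rw [hq a, hq b, hab])
    calc coveringDensityOn (unitBall n) (periodicSet Λ x) (cube n r)
        = ∑' p : periodicSet Λ x, (fun q : ι × Λ => volume (cube n r ∩
            (q.2 +ᵥ (x q.1 +ᵥ unitBall n))) / volume (cube n r)) (q p) := by
          refine tsum_congr fun p => ?_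
          simp only
          rw [hq p, Submodule.vadd_def, vadd_vadd]
      _ ≤ ∑' q : ι × Λ, volume (cube n r ∩
            (q.2 +ᵥ (x q.1 +ᵥ unitBall n))) / volume (cube n r) :=
          ENNReal.tsum_comp_le_tsum_of_injective hinj _
      _ = ∑ i, (∑' l : Λ, volume (cube n r ∩
            (l +ᵥ (x i +ᵥ unitBall n)))) / volume (cube n r) := by
          rw [ENNReal.tsum_prod (f := fun i (l : Λ) => volume (cube n r ∩
            (l +ᵥ (x i +ᵥ unitBall n))) / volume (cube n r)), tsum_fintype]
          refine Finset.sum_congr rfl fun i _ => ?_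
          simp only [div_eq_mul_inv, ENNReal.tsum_mul_right]
      _ ≤ _ := by
          refine Finset.sum_le_sum fun i _ => ?_
          have h1 := hs i r hr.le
          rw [measure_vadd] at h1
          have h2 : (0 : ℝ) < (2 * r) ^ n := by positivity
          have h3 := hs0 i
          rw [volume_cube n hr.le]
          have h4 : ENNReal.ofReal (((r + s i) / r) ^ n) =
              ENNReal.ofReal ((2 * (r + s i)) ^ n) / ENNReal.ofReal ((2 * r) ^ n) := by
            rw [← ENNReal.ofReal_div_of_pos h2, ← div_pow]
            congr 2; field_simp
          rw [h4, ← mul_div_assoc]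
          refine ENNReal.div_le_div_right ?_ _
          rw [← ENNReal.mul_div_right_comm]
          exact (ENNReal.le_div_iff_mul_le (Or.inl hD0) (Or.inl h.volume_ne_top)).2 h1
  refine (limsup_le_limsup hle).trans ?_
  rw [hlim.limsup_eq]
  simp

end IsPeriod

/-! ### Conditional expectations and periodization -/

/-- Method of conditional expectations for independent sampling: if `g e` has mean at most `a e`,
some sequence of `m` points makes the weighted sum of the products `∏ i, g e (x i)` at most
the corresponding sum of the `a e ^ m`. -/
lemma exists_sum_mul_prod_le {α ι : Type*} [MeasurableSpace α] (μ : Measure α)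
    [IsProbabilityMeasure μ] (s : Finset ι) (g : ι → α → ℝ≥0∞) (hg : ∀ e ∈ s, Measurable (g e))
    (a : ι → ℝ≥0∞) (ha : ∀ e ∈ s, ∫⁻ x, g e x ∂μ ≤ a e) (m : ℕ) (c : ι → ℝ≥0∞) :
    ∃ x : Fin m → α, ∑ e ∈ s, c e * ∏ i, g e (x i) ≤ ∑ e ∈ s, c e * a e ^ m := by
  induction m generalizing c with
  | zero => exact ⟨Fin.elim0, by simp⟩
  | succ m ih =>
    obtain ⟨x, hx⟩ := exists_le_lintegral (μ := μ) (f := fun x => ∑ e ∈ s, c e * a e ^ m * g e x)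
      (Finset.measurable_fun_sum _ fun e he => (hg e he).const_mul _).aemeasurable
    obtain ⟨y, hy⟩ := ih fun e => c e * g e x
    refine ⟨Fin.cons x y, ?_⟩
    calc ∑ e ∈ s, c e * ∏ i, g e ((Fin.cons x y : Fin (m + 1) → α) i)
        = ∑ e ∈ s, c e * g e x * ∏ i, g e (y i) := by
          refine Finset.sum_congr rfl fun e _ => ?_
          rw [Fin.prod_univ_succ, mul_assoc]
          simp
      _ ≤ ∑ e ∈ s, c e * a e ^ m * g e x := by
          refine hy.trans_eq (Finset.sum_congr rfl fun e _ => ?_)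
          rw [mul_right_comm]
      _ ≤ ∫⁻ x, ∑ e ∈ s, c e * a e ^ m * g e x ∂μ := hx
      _ = ∑ e ∈ s, c e * a e ^ m * ∫⁻ x, g e x ∂μ := by
          rw [lintegral_finsetSum' _ fun e he => ((hg e he).const_mul _).aemeasurable]
          exact Finset.sum_congr rfl fun e he => lintegral_const_mul _ (hg e he)
      _ ≤ ∑ e ∈ s, c e * a e ^ (m + 1) := by
          refine Finset.sum_le_sum fun e he => ?_
          rw [pow_succ, ← mul_assoc]
          gcongr
          exact ha e he

/-- The `Λ`-periodic function that equals `H` on `B` and `1` outside of `B + Λ`; it is meant for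
sets `B` whose `Λ`-translates are disjoint. -/
noncomputable def periodize {n : ℕ} (Λ : Submodule ℤ (Euc n)) (B : Set (Euc n))
    (H : Euc n → ℝ≥0∞) (x : Euc n) : ℝ≥0∞ :=
  (∑' l : Λ, B.indicator H (l +ᵥ x)) + (1 - ∑' l : Λ, B.indicator 1 (l +ᵥ x))

namespace IsPeriod

variable {n : ℕ} {d : ℝ} {Λ : Submodule ℤ (Euc n)} {D : Set (Euc n)}

lemma tsum_indicator_of_mem (h : IsPeriod d Λ D) {B : Set (Euc n)}
    (hB : ∀ a ∈ B, ∀ b ∈ B, ‖a - b‖ < d) (H : Euc n → ℝ≥0∞) {x : Euc n} {l : Λ}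
    (hl : l +ᵥ x ∈ B) : ∑' l : Λ, B.indicator H (l +ᵥ x) = H (l +ᵥ x) := by
  rw [tsum_eq_single l, Set.indicator_of_mem hl]
  intro l' hne
  refine Set.indicator_of_notMem (fun hl' => hne ?_) _
  have := h.eq_zero (Λ.sub_mem l'.2 l.2) (by
    have := hB _ hl' _ hl
    simpa [Submodule.vadd_def] using this)
  exact Subtype.ext (sub_eq_zero.1 this)

lemma periodize_of_mem (h : IsPeriod d Λ D) {B : Set (Euc n)}
    (hB : ∀ a ∈ B, ∀ b ∈ B, ‖a - b‖ < d) (H : Euc n → ℝ≥0∞) {x l : Euc n} (hl : l ∈ Λ)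
    (hx : l + x ∈ B) : periodize Λ B H x = H (l + x) := by
  have hx' : (⟨l, hl⟩ : Λ) +ᵥ x ∈ B := hx
  rw [periodize, h.tsum_indicator_of_mem hB H hx', h.tsum_indicator_of_mem hB 1 hx']
  simp [Submodule.vadd_def]

lemma periodize_of_notMem {B : Set (Euc n)} (H : Euc n → ℝ≥0∞) {x : Euc n}
    (hx : ∀ l ∈ Λ, l + x ∉ B) : periodize Λ B H x = 1 := by
  have : ∀ l : Λ, l +ᵥ x ∉ B := fun l => hx l l.2
  simp [periodize, this]

lemma measurable_periodize (h : IsPeriod d Λ D) {B : Set (Euc n)} (hBm : MeasurableSet B)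
    {H : Euc n → ℝ≥0∞} (hH : Measurable H) : Measurable (periodize Λ B H) := by
  have := h.countable
  have key : ∀ F : Euc n → ℝ≥0∞, Measurable F →
      Measurable fun x : Euc n => ∑' l : Λ, B.indicator F (l +ᵥ x) := fun F hF =>
    Measurable.tsum fun l => (hF.indicator hBm).comp (measurable_const_add (l : Euc n))
  exact (key H hH).add (measurable_const.sub (key 1 measurable_one))

lemma setLIntegral_tsum_indicator (h : IsPeriod d Λ D) {B : Set (Euc n)} (hBm : MeasurableSet B)
    {H : Euc n → ℝ≥0∞} (hH : Measurable H) :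
    ∫⁻ x in D, ∑' l : Λ, B.indicator H (l +ᵥ x) = ∫⁻ x in B, H x := by
  have := h.countable
  have hm : ∀ l : Λ, Measurable fun x : Euc n => B.indicator H (l +ᵥ x) := fun l =>
    (hH.indicator hBm).comp (measurable_const_add (l : Euc n))
  rw [lintegral_tsum fun l => (hm l).aemeasurable, ← lintegral_indicator hBm, h.isAddFundamentalDomain.lintegral_eq_tsum'']

lemma setLIntegral_periodize (h : IsPeriod d Λ D) {B : Set (Euc n)} (hBm : MeasurableSet B)
    (hB : ∀ a ∈ B, ∀ b ∈ B, ‖a - b‖ < d) {H : Euc n → ℝ≥0∞} (hH : Measurable H) :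
    ∫⁻ x in D, periodize Λ B H x = (∫⁻ x in B, H x) + (volume D - volume B) ∧
      volume B ≤ volume D := by
  have := h.countable
  have hle : ∀ x : Euc n, ∑' l : Λ, B.indicator (1 : Euc n → ℝ≥0∞) (l +ᵥ x) ≤ 1 := by
    intro x
    by_cases hx : ∃ l : Λ, l +ᵥ x ∈ B
    · obtain ⟨l, hl⟩ := hx
      rw [h.tsum_indicator_of_mem hB 1 hl]; rfl
    · push Not at hx
      simp [hx]
  have key : ∀ F : Euc n → ℝ≥0∞, Measurable F →
      Measurable fun x : Euc n => ∑' l : Λ, B.indicator F (l +ᵥ x) := fun F hF =>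
    Measurable.tsum fun l => (hF.indicator hBm).comp (measurable_const_add (l : Euc n))
  have hone := h.setLIntegral_tsum_indicator hBm (H := 1) measurable_one
  simp only [Pi.one_apply, lintegral_one, Measure.restrict_apply_univ] at hone
  have hBD : volume B ≤ volume D := by
    rw [← hone]
    calc _ ≤ ∫⁻ _ in D, 1 := lintegral_mono hle
      _ = volume D := by simp
  refine ⟨?_, hBD⟩
  unfold periodize
  rw [lintegral_add_left (key H hH), h.setLIntegral_tsum_indicator hBm hH,
    lintegral_sub (key 1 measurable_one) _ (Eventually.of_forall hle), hone]
  · simp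
  · rw [hone]
    exact (hBD.trans_lt h.volume_ne_top.lt_top).ne

lemma volume_ne_zero (h : IsPeriod d Λ D) : volume D ≠ 0 :=
  have := h.countable
  h.isAddFundamentalDomain.measure_ne_zero (NeZero.ne volume)

/-- Normalized Lebesgue measure on a fundamental domain. -/
noncomputable def unif (D : Set (Euc n)) : Measure (Euc n) := (volume D)⁻¹ • volume.restrict D

lemma isProbabilityMeasure_unif (h : IsPeriod d Λ D) : IsProbabilityMeasure (unif D) :=
  ⟨by simp [unif, ENNReal.inv_mul_cancel h.volume_ne_zero h.volume_ne_top]⟩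

/-- If `H` has mean at most `κ` on `B`, and `q` is the proportion of space covered by `B + Λ`,
then the periodization of `H` has mean at most `1 + (κ - 1) q ≤ exp ((κ - 1) q)`. -/
lemma lintegral_periodize_le (h : IsPeriod d Λ D) {B : Set (Euc n)} (hBm : MeasurableSet B)
    (hB : ∀ a ∈ B, ∀ b ∈ B, ‖a - b‖ < d) {H : Euc n → ℝ≥0∞} (hH : Measurable H)
    {κ : ℝ} (hκ : 0 ≤ κ) (hHB : ∫⁻ x in B, H x ≤ ENNReal.ofReal κ * volume B) :
    ∫⁻ x, periodize Λ B H x ∂(unif D) ≤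
      ENNReal.ofReal (Real.exp ((κ - 1) * (volume.real B / volume.real D))) := by
  obtain ⟨h1, h2⟩ := h.setLIntegral_periodize hBm hB hH
  have hD := h.volume_ne_top
  have hD0 : 0 < volume.real D := ENNReal.toReal_pos h.volume_ne_zero hD
  have hBf : volume B ≠ ∞ := (h2.trans_lt hD.lt_top).ne
  have h3 : volume.real B ≤ volume.real D := ENNReal.toReal_mono hD h2
  rw [unif, lintegral_smul_measure, h1, smul_eq_mul]
  calc (volume D)⁻¹ * ((∫⁻ x in B, H x) + (volume D - volume B))
      ≤ (volume D)⁻¹ * (ENNReal.ofReal κ * volume B + (volume D - volume B)) := by gcongr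
    _ = ENNReal.ofReal ((volume.real D)⁻¹ *
          (κ * volume.real B + (volume.real D - volume.real B))) := by
        rw [ENNReal.ofReal_mul (by positivity), ENNReal.ofReal_inv_of_pos hD0,
          ENNReal.ofReal_add (by positivity) (by linarith), ENNReal.ofReal_mul hκ,
          ENNReal.ofReal_sub _ (by positivity), ofReal_measureReal hD, ofReal_measureReal hBf]
    _ ≤ _ := by
        refine ENNReal.ofReal_le_ofReal ?_
        refine le_trans (le_of_eq ?_) (Real.add_one_le_exp _)
        field_simp
        ring

end IsPeriod

/-! ### Caps and exponential moments on balls -/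

/-- A spherical cap at distance `h` from the centre has relative volume at most `exp (-n h² / 8)`,
because it lies in a smaller ball. The direction `w` is only required to have norm at most `2`. -/
lemma volume_cap_le {n : ℕ} (y w : Euc n) (hw : ‖w‖ ≤ 2) {ρ h : ℝ} (hρ0 : 0 ≤ ρ) (hρ : ρ ≤ 1)
    (hh : 0 ≤ h) :
    volume {v ∈ Metric.closedBall y ρ | h ≤ inner ℝ (v - y) w} ≤
      ENNReal.ofReal (Real.exp (-(n * h ^ 2 / 8))) * volume (Metric.closedBall y ρ) := by
  have hsub : {v ∈ Metric.closedBall y ρ | h ≤ inner ℝ (v - y) w} ⊆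
      Metric.closedBall (y + (h / 4) • w) (ρ * Real.exp (-(h ^ 2 / 8))) := by
    rintro v ⟨hv, hvw⟩
    rw [Metric.mem_closedBall, dist_eq_norm] at hv ⊢
    refine abs_le_of_sq_le_sq' ?_ (by positivity) |>.2
    have e : v - (y + (h / 4) • w) = (v - y) - (h / 4) • w := by abel
    rw [e, norm_sub_sq_real, inner_smul_right, norm_smul, Real.norm_of_nonneg (by positivity),
      mul_pow ρ, ← Real.exp_nat_mul]
    have h1 : ‖v - y‖ ^ 2 ≤ ρ ^ 2 := pow_le_pow_left₀ (norm_nonneg _) hv 2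
    have h2 : ‖w‖ ^ 2 ≤ 4 := by nlinarith [norm_nonneg w]
    have h3 : 1 - h ^ 2 / 4 ≤ Real.exp ((2 : ℕ) * (-(h ^ 2 / 8))) := by
      have := Real.add_one_le_exp ((2 : ℕ) * (-(h ^ 2 / 8)))
      push_cast at this ⊢
      linarith
    have h4 : ρ ^ 2 * (1 - h ^ 2 / 4) ≤ ρ ^ 2 * Real.exp ((2 : ℕ) * (-(h ^ 2 / 8))) :=
      mul_le_mul_of_nonneg_left h3 (sq_nonneg _)
    have h5 : ρ ^ 2 * h ^ 2 ≤ h ^ 2 := mul_le_of_le_one_left (sq_nonneg _) (by nlinarith)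
    have h6 : h * h ≤ h * inner ℝ (v - y) w := mul_le_mul_of_nonneg_left hvw hh
    have h7 : h ^ 2 * ‖w‖ ^ 2 ≤ h ^ 2 * 4 := mul_le_mul_of_nonneg_left h2 (sq_nonneg _)
    nlinarith
  refine (measure_mono hsub).trans (le_of_eq ?_)
  rw [IsPeriod.volume_closedBall_eq n _ (by positivity), IsPeriod.volume_closedBall_eq n _ hρ0,
    ← mul_assoc, ← ENNReal.ofReal_mul (by positivity), mul_pow, ← Real.exp_nat_mul]
  congr 2
  rw [mul_comm]
  congr 2
  ring

/-- Exponential moment of a linear functional over a ball. The linear factor in `n` comes from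
adding up the caps `{j ≤ √n ⟪v, w⟫}` one by one; it is harmless for the application. -/
lemma lintegral_exp_inner_le {n : ℕ} (y w : Euc n) (hw : ‖w‖ ≤ 2) {ρ : ℝ}
    (hρ0 : 0 ≤ ρ) (hρ : ρ ≤ 1) :
    ∫⁻ v in Metric.closedBall y ρ, ENNReal.ofReal (Real.exp (√n * inner ℝ (v - y) w)) ≤
      ENNReal.ofReal (Real.exp 3 * (2 * n + 2)) * volume (Metric.closedBall y ρ) := by
  rcases Nat.eq_zero_or_pos n with rfl | hn
  · simp only [CharP.cast_eq_zero, Real.sqrt_zero, zero_mul, Real.exp_zero, ENNReal.ofReal_one,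
      lintegral_const, one_mul, Measure.restrict_apply_univ]
    refine le_mul_of_one_le_left (zero_le) ?_
    rw [ENNReal.one_le_ofReal]
    have := Real.add_one_le_exp (3 : ℝ)
    linarith
  set B := Metric.closedBall y ρ with hBdef
  have hsn : 0 < √(n : ℝ) := Real.sqrt_pos.2 (by exact_mod_cast hn)
  have hsn2 : √(n : ℝ) ^ 2 = n := Real.sq_sqrt (Nat.cast_nonneg n)
  have hsnn : √(n : ℝ) ≤ n := by
    have h1 : (1 : ℝ) ≤ n := by exact_mod_cast hn
    rw [Real.sqrt_le_left (by positivity)]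
    nlinarith
  let A : ℕ → Set (Euc n) := fun j => {v ∈ B | j / √n ≤ inner ℝ (v - y) w}
  have hA : ∀ j, MeasurableSet (A j) := fun j =>
    measurableSet_closedBall.inter (measurableSet_le measurable_const
      (by fun_prop : Measurable fun v : Euc n => inner ℝ (v - y) w))
  have hpt : ∀ v ∈ B, ENNReal.ofReal (Real.exp (√n * inner ℝ (v - y) w)) ≤
      1 + ∑ j ∈ Finset.range (2 * n + 1),
        (A j).indicator (fun _ => ENNReal.ofReal (Real.exp (j + 1))) v := by
    intro v hv
    set t := √(n : ℝ) * inner ℝ (v - y) w with ht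
    rcases lt_or_ge t 0 with h0 | h0
    · refine le_trans ?_ le_self_add
      rw [ENNReal.ofReal_le_one]
      exact Real.exp_le_one_iff.2 h0.le
    · have ht2 : t ≤ 2 * n := by
        have h1 : inner ℝ (v - y) w ≤ 1 * 2 := by
          refine (real_inner_le_norm _ _).trans ?_
          have : ‖v - y‖ ≤ 1 := by
            rw [← dist_eq_norm]; exact (Metric.mem_closedBall.1 hv).trans hρ
          exact mul_le_mul this hw (norm_nonneg _) zero_le_one
        calc t ≤ √n * (1 * 2) := mul_le_mul_of_nonneg_left h1 hsn.le
          _ ≤ _ := by linarith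
      have hfl : ⌊t⌋₊ ∈ Finset.range (2 * n + 1) := by
        rw [Finset.mem_range, Nat.lt_succ_iff]
        refine Nat.floor_le_of_le ?_
        push_cast; exact ht2
      have hmem : v ∈ A ⌊t⌋₊ := by
        refine ⟨hv, ?_⟩
        rw [div_le_iff₀ hsn, mul_comm]
        exact Nat.floor_le h0
      calc ENNReal.ofReal (Real.exp t)
          ≤ (A ⌊t⌋₊).indicator (fun _ => ENNReal.ofReal (Real.exp (⌊t⌋₊ + 1))) v := by
            rw [Set.indicator_of_mem hmem]
            exact ENNReal.ofReal_le_ofReal (Real.exp_le_exp.2 (Nat.lt_floor_add_one t).le)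
        _ ≤ ∑ j ∈ Finset.range (2 * n + 1),
              (A j).indicator (fun _ => ENNReal.ofReal (Real.exp (j + 1))) v :=
            Finset.single_le_sum
              (f := fun j : ℕ => (A j).indicator (fun _ => ENNReal.ofReal (Real.exp (j + 1))) v)
              (fun _ _ => zero_le) hfl
        _ ≤ _ := le_add_self
  have hterm : ∀ j : ℕ, ENNReal.ofReal (Real.exp (j + 1)) * volume (A j) ≤
      ENNReal.ofReal (Real.exp 3) * volume B := by
    intro j
    calc _ ≤ ENNReal.ofReal (Real.exp (j + 1)) *
          (ENNReal.ofReal (Real.exp (-(n * (j / √n) ^ 2 / 8))) * volume B) := by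
          gcongr
          exact volume_cap_le y w hw hρ0 hρ (by positivity)
      _ ≤ _ := by
          rw [← mul_assoc, ← ENNReal.ofReal_mul (by positivity), ← Real.exp_add]
          gcongr
          rw [div_pow, hsn2, mul_div_cancel₀ _ (by positivity : (n : ℝ) ≠ 0)]
          -- the exponent `j + 1 - j² / 8` is largest at `j = 4`
          nlinarith [sq_nonneg ((j : ℝ) - 4)]
  calc _ ≤ ∫⁻ v in B, (1 + ∑ j ∈ Finset.range (2 * n + 1),
        (A j).indicator (fun _ => ENNReal.ofReal (Real.exp (j + 1))) v) :=
        setLIntegral_mono' measurableSet_closedBall hpt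
    _ = volume B + ∑ j ∈ Finset.range (2 * n + 1),
          ENNReal.ofReal (Real.exp (j + 1)) * volume (A j) := by
        rw [lintegral_add_left measurable_const, lintegral_finsetSum _ fun j _ =>
          (measurable_const.indicator (hA j))]
        congr 1
        · simp
        · refine Finset.sum_congr rfl fun j _ => ?_
          rw [lintegral_indicator_const (hA j), Measure.restrict_apply (hA j),
            Set.inter_eq_left.2 fun v hv => hv.1]
    _ ≤ volume B + ∑ _j ∈ Finset.range (2 * n + 1), ENNReal.ofReal (Real.exp 3) * volume B := by
        exact add_le_add le_rfl (Finset.sum_le_sum fun j _ => hterm j)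
    _ ≤ ENNReal.ofReal (Real.exp 3) * volume B +
          ∑ _j ∈ Finset.range (2 * n + 1), ENNReal.ofReal (Real.exp 3) * volume B := by
        gcongr
        refine le_mul_of_one_le_left (zero_le) ?_
        rw [ENNReal.one_le_ofReal]
        exact Real.one_le_exp (by norm_num)
    _ = _ := by
        rw [Finset.sum_const, Finset.card_range, nsmul_eq_mul,
          ENNReal.ofReal_mul (by positivity)]
        have : ENNReal.ofReal (2 * n + 2) = ((2 * n + 1 : ℕ) : ℝ≥0∞) + 1 := by
          rw [← ENNReal.ofReal_natCast, ← ENNReal.ofReal_one,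
            ← ENNReal.ofReal_add (by positivity) (by positivity)]
          congr 1; push_cast; ring
        rw [this]
        ring

/-! ### The union bound -/

namespace IsPeriod

variable {n : ℕ} {d : ℝ} {Λ : Submodule ℤ (Euc n)} {D : Set (Euc n)}

/-- The density of the packing of unit balls centred at the points of a lattice with fundamental
domain `D`. -/
noncomputable def ballRatio (D : Set (Euc n)) : ℝ := volume.real (unitBall n) / volume.real D

lemma volume_real_closedBall_div (y : Euc n) {r : ℝ} (hr : 0 ≤ r) :
    volume.real (Metric.closedBall y r) / volume.real D = r ^ n * ballRatio D := by
  simp only [Measure.real, volume_closedBall_eq n y hr, ENNReal.toReal_mul,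
    ENNReal.toReal_ofReal (pow_nonneg hr n), ballRatio, mul_div_assoc]

/-- Finitely many directions suffice to detect the norm of a vector up to a factor `2`. A net of
the unit sphere modulo `Λ` can be lifted since at most one point of each coset is short. -/
lemma exists_directions (h : IsPeriod 4 Λ D) :
    ∃ W : Finset (Euc n), (W.card : ℝ) ≤ 32 ^ n ∧ (∀ w ∈ W, ‖w‖ ≤ 2) ∧
      ∀ S : Euc n, ∃ w ∈ W, ‖S‖ / 2 ≤ inner ℝ S w := by
  classical
  obtain ⟨Y, hY, hc⟩ := h.exists_net (r := 1 / 2) (by norm_num) (by norm_num)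
  have hrep : ∀ y : Euc n, ∃ w : Euc n, ‖w‖ ≤ 2 ∧ ∀ l ∈ Λ, ‖l + y‖ ≤ 3 / 2 → w = l + y := by
    intro y
    by_cases hy : ∃ l ∈ Λ, ‖l + y‖ ≤ 3 / 2
    · obtain ⟨l, hl, hly⟩ := hy
      refine ⟨l + y, by linarith, fun l' hl' hly' => ?_⟩
      have : l - l' = 0 := by
        refine h.eq_zero (Λ.sub_mem hl hl') ?_
        have e : l - l' = (l + y) - (l' + y) := by abel
        rw [e]
        exact (norm_sub_le _ _).trans_lt (by linarith)
      rw [sub_eq_zero.1 this]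
    · push Not at hy
      exact ⟨0, by simp, fun l hl hly => absurd hly (not_le.2 (hy l hl))⟩
  choose f hf2 hf using hrep
  refine ⟨Y.image f, ?_, ?_, ?_⟩
  · refine le_trans (by exact_mod_cast Finset.card_image_le) (hc.trans (le_of_eq ?_))
    norm_num
  · intro w hw
    obtain ⟨y, -, rfl⟩ := Finset.mem_image.1 hw
    exact hf2 y
  · have key : ∀ u : Euc n, ‖u‖ ≤ 1 → ∃ w ∈ Y.image f, ‖u - w‖ ≤ 1 / 2 := by
      intro u hu
      obtain ⟨y, hy, l, hl, hly⟩ := hY u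
      refine ⟨f y, Finset.mem_image_of_mem f hy, ?_⟩
      rwa [hf y l hl]
      have e : l + y = u - (u - (l + y)) := by abel
      rw [e]
      exact (norm_sub_le _ _).trans (by linarith)
    intro S
    by_cases hS : S = 0
    · obtain ⟨w, hw, -⟩ := key 0 (by simp)
      exact ⟨w, hw, by simp [hS]⟩
    · have hS' : 0 < ‖S‖ := norm_pos_iff.2 hS
      obtain ⟨w, hw, hle⟩ := key (‖S‖⁻¹ • S) (by
        rw [norm_smul, norm_inv, norm_norm, inv_mul_cancel₀ hS'.ne'])
      refine ⟨w, hw, ?_⟩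
      have e : inner ℝ S w = ‖S‖ - inner ℝ S (‖S‖⁻¹ • S - w) := by
        rw [inner_sub_right, inner_smul_right, real_inner_self_eq_norm_sq]
        field_simp
        ring
      have h1 : inner ℝ S (‖S‖⁻¹ • S - w) ≤ ‖S‖ * (1 / 2) :=
        (real_inner_le_norm _ _).trans (mul_le_mul_of_nonneg_left hle hS'.le)
      rw [e]
      linarith

/-- Periodization of the exponential weight that detects whether the points in `B (y, ρ)` are on
average pushed in the direction `w` by at least `τ / 2`. -/
noncomputable def coverWeight (Λ : Submodule ℤ (Euc n)) (ρ τ : ℝ) (y w : Euc n) :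
    Euc n → ℝ≥0∞ :=
  periodize Λ (Metric.closedBall y ρ)
    fun v => ENNReal.ofReal (Real.exp (√n * (inner ℝ (v - y) w - τ / 2)))

/-- Periodization of the weight `K` on the ball `B (y, r)`: it counts the points in that ball. -/
noncomputable def countWeight (Λ : Submodule ℤ (Euc n)) (K r : ℝ) (y : Euc n) :
    Euc n → ℝ≥0∞ :=
  periodize Λ (Metric.closedBall y r) fun _ => ENNReal.ofReal K

lemma norm_sub_lt_of_mem_closedBall {y : Euc n} {r : ℝ} (hr : 2 * r < d) :
    ∀ a ∈ Metric.closedBall y r, ∀ b ∈ Metric.closedBall y r, ‖a - b‖ < d := by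
  intro a ha b hb
  rw [← dist_eq_norm]
  have h1 := dist_triangle_right a b y
  rw [Metric.mem_closedBall] at ha hb
  linarith

lemma measurable_coverWeight (h : IsPeriod d Λ D) (ρ τ : ℝ) (y w : Euc n) :
    Measurable (coverWeight Λ ρ τ y w) :=
  h.measurable_periodize measurableSet_closedBall (by fun_prop)

lemma measurable_countWeight (h : IsPeriod d Λ D) (K r : ℝ) (y : Euc n) :
    Measurable (countWeight Λ K r y) :=
  h.measurable_periodize measurableSet_closedBall measurable_const

/-- For `τ` a large multiple of `log n / √n` the first factor of the exponent is close to `-1`: the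
points of `B (y, ρ)` are hardly ever pushed that far in the direction `w`, so the mean of the weight
is almost the exponential of minus the proportion of space covered by `B (y, ρ) + Λ`. -/
lemma lintegral_coverWeight_le (h : IsPeriod 4 Λ D) {ρ : ℝ} (hρ0 : 0 ≤ ρ) (hρ : ρ ≤ 1) (τ : ℝ)
    (y : Euc n) {w : Euc n} (hw : ‖w‖ ≤ 2) :
    ∫⁻ x, coverWeight Λ ρ τ y w x ∂(unif D) ≤ ENNReal.ofReal (Real.exp
      ((Real.exp (-(√n * τ / 2)) * (Real.exp 3 * (2 * n + 2)) - 1) * (ρ ^ n * ballRatio D))) := by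
  rw [← volume_real_closedBall_div y hρ0]
  refine h.lintegral_periodize_le measurableSet_closedBall
    (norm_sub_lt_of_mem_closedBall (by linarith)) (by fun_prop) (by positivity) ?_
  have e : ∀ v : Euc n, ENNReal.ofReal (Real.exp (√n * (inner ℝ (v - y) w - τ / 2))) =
      ENNReal.ofReal (Real.exp (-(√n * τ / 2))) *
        ENNReal.ofReal (Real.exp (√n * inner ℝ (v - y) w)) := by
    intro v
    rw [← ENNReal.ofReal_mul (by positivity), ← Real.exp_add]
    congr 2
    ring
  simp only [e]
  rw [lintegral_const_mul _ (by fun_prop), ENNReal.ofReal_mul (by positivity), mul_assoc]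
  gcongr
  exact lintegral_exp_inner_le y w hw hρ0 hρ

lemma lintegral_countWeight_le (h : IsPeriod d Λ D) {K r : ℝ} (hK : 0 ≤ K) (hr0 : 0 ≤ r)
    (hr : 2 * r < d) (y : Euc n) :
    ∫⁻ x, countWeight Λ K r y x ∂(unif D) ≤
      ENNReal.ofReal (Real.exp ((K - 1) * (r ^ n * ballRatio D))) := by
  rw [← volume_real_closedBall_div y hr0]
  exact h.lintegral_periodize_le measurableSet_closedBall
    (norm_sub_lt_of_mem_closedBall hr) measurable_const hK (by simp)

/-- If `z` is not covered, then the points of the set lying in `B (y, ρ)`, where `y` is the net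
point next to `z`, are all displaced from `y` by more than `τ` in the direction opposite to `z - y`.
So their sum is large, and the weight of `y` and some direction `w` of the net is at least `1`. -/
lemma exists_one_le_prod_coverWeight (h : IsPeriod 4 Λ D) {ε τ ρ : ℝ} (hε : 0 < ε)
    (hρ1 : ρ ≤ 1) (hρ : ρ ^ 2 = 1 - ε ^ 2 - 2 * ε * τ)
    {Y W : Finset (Euc n)} (hY : ∀ x, ∃ y ∈ Y, ∃ l ∈ Λ, ‖x - (l + y)‖ ≤ ε)
    (hW : ∀ S : Euc n, ∃ w ∈ W, ‖S‖ / 2 ≤ inner ℝ S w) {m : ℕ} (x : Fin m → Euc n) {z : Euc n}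
    (hz : ∀ i, ∀ l ∈ Λ, 1 < ‖z - (l + x i)‖) :
    ∃ y ∈ Y, ∃ w ∈ W, 1 ≤ ∏ i, coverWeight Λ ρ τ y w (x i) := by
  classical
  obtain ⟨y, hy, l₀, hl₀, hzy⟩ := hY z
  refine ⟨y, hy, ?_⟩
  set u := z - (l₀ + y) with hu
  let I : Finset (Fin m) := Finset.univ.filter fun i => ∃ l ∈ Λ, l + x i ∈ Metric.closedBall y ρ
  have hI : ∀ i ∈ I, ∃ l ∈ Λ, l + x i ∈ Metric.closedBall y ρ := fun i hi =>
    (Finset.mem_filter.1 hi).2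
  choose! l hl hlx using hI
  let v : Fin m → Euc n := fun i => l i + x i - y
  have hv : ∀ i ∈ I, ε * τ ≤ inner ℝ (v i) (-u) := by
    intro i hi
    have h1 : ‖v i‖ ≤ ρ := by
      have := hlx i hi
      rwa [Metric.mem_closedBall, dist_eq_norm] at this
    have h2 : 1 < ‖v i - u‖ := by
      have := hz i (l₀ + l i) (Λ.add_mem hl₀ (hl i hi))
      have e : v i - u = -(z - (l₀ + l i + x i)) := by simp only [v, hu]; abel
      rwa [e, norm_neg]
    have h3 : 1 < ‖v i - u‖ ^ 2 := by nlinarith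
    rw [norm_sub_sq_real] at h3
    have h4 : ‖v i‖ ^ 2 ≤ ρ ^ 2 := pow_le_pow_left₀ (norm_nonneg _) h1 2
    have h5 : ‖u‖ ^ 2 ≤ ε ^ 2 := pow_le_pow_left₀ (norm_nonneg _) hzy 2
    rw [inner_neg_right]
    linarith
  have hS : I.card * τ ≤ ‖∑ i ∈ I, v i‖ := by
    have h1 : (I.card : ℝ) * (ε * τ) ≤ inner ℝ (∑ i ∈ I, v i) (-u) := by
      rw [sum_inner, ← nsmul_eq_mul]
      exact Finset.card_nsmul_le_sum _ _ _ hv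
    have h2 : inner ℝ (∑ i ∈ I, v i) (-u) ≤ ‖∑ i ∈ I, v i‖ * ε :=
      (real_inner_le_norm _ _).trans (by rw [norm_neg]; gcongr)
    refine le_of_mul_le_mul_right (a := ε) ?_ hε
    linarith
  obtain ⟨w, hw, hSw⟩ := hW (∑ i ∈ I, v i)
  refine ⟨w, hw, ?_⟩
  have hval : ∀ i, coverWeight Λ ρ τ y w (x i) =
      if i ∈ I then ENNReal.ofReal (Real.exp (√n * (inner ℝ (v i) w - τ / 2))) else 1 := by
    intro i
    split_ifs with hi
    · exact h.periodize_of_mem (norm_sub_lt_of_mem_closedBall (by linarith)) _ (hl i hi)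
        (hlx i hi)
    · refine periodize_of_notMem _ fun l hl hlx => hi ?_
      exact Finset.mem_filter.2 ⟨Finset.mem_univ _, l, hl, hlx⟩
  simp only [hval]
  rw [Finset.prod_ite_mem, Finset.univ_inter,
    ← ENNReal.ofReal_prod_of_nonneg fun _ _ => (Real.exp_pos _).le, ← Real.exp_sum,
    ENNReal.one_le_ofReal]
  refine Real.one_le_exp ?_
  rw [← Finset.mul_sum, Finset.sum_sub_distrib, ← sum_inner, Finset.sum_const, nsmul_eq_mul]
  refine mul_nonneg (Real.sqrt_nonneg _) ?_
  linarith

/-- The multiplicity at `z` is at most the number of points, modulo `Λ`, in a slightly larger ball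
around the net point next to `z`, and the weight counts these points. -/
lemma exists_multiplicityAt_le_prod_countWeight (h : IsPeriod 4 Λ D) {ε K : ℝ}
    (hε : ε < 1) {Y : Finset (Euc n)}
    (hY : ∀ x, ∃ y ∈ Y, ∃ l ∈ Λ, ‖x - (l + y)‖ ≤ ε) {m : ℕ} (x : Fin m → Euc n) (z : Euc n) :
    ∃ y ∈ Y, ∃ j : ℕ, coveringMultiplicityAt (unitBall n) (periodicSet Λ x) z ≤ j ∧
      ∏ i, countWeight Λ K (1 + ε) y (x i) = ENNReal.ofReal K ^ j := by
  classical
  obtain ⟨y, hy, l₀, hl₀, hzy⟩ := hY z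
  let I : Finset (Fin m) :=
    Finset.univ.filter fun i => ∃ l ∈ Λ, l + x i ∈ Metric.closedBall y (1 + ε)
  refine ⟨y, hy, I.card, ?_, ?_⟩
  · refine h.coveringMultiplicityAt_le (by norm_num) x z I ?_
    rintro i ⟨l, hl, hlx⟩
    refine Finset.mem_filter.2 ⟨Finset.mem_univ _, l - l₀, Λ.sub_mem hl hl₀, ?_⟩
    rw [Metric.mem_closedBall, dist_eq_norm]
    have e : l - l₀ + x i - y = (z - (l₀ + y)) - (z - (l + x i)) := by abel
    rw [e]
    exact (norm_sub_le _ _).trans (by linarith)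
  · have hval : ∀ i, countWeight Λ K (1 + ε) y (x i) = if i ∈ I then ENNReal.ofReal K else 1 := by
      intro i
      split_ifs with hi
      · obtain ⟨l, hl, hlx⟩ := (Finset.mem_filter.1 hi).2
        exact h.periodize_of_mem (norm_sub_lt_of_mem_closedBall (by linarith)) _ hl hlx
      · refine periodize_of_notMem _ fun l hl hlx => hi ?_
        exact Finset.mem_filter.2 ⟨Finset.mem_univ _, l, hl, hlx⟩
    simp only [hval]
    rw [Finset.prod_ite_mem, Finset.univ_inter, Finset.prod_const]

lemma isCovering_periodicSet (h : IsPeriod d Λ D) (hd : 2 < d) {ι : Type*} [Fintype ι]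
    (x : ι → Euc n) (hx : ∀ z, ∃ i, ∃ l ∈ Λ, ‖z - (l + x i)‖ ≤ 1) :
    IsCovering (unitBall n) (periodicSet Λ x) Set.univ := by
  refine ⟨h.isDiscrete_periodicSet hd x, fun z _ => ?_⟩
  obtain ⟨i, l, hl, hz⟩ := hx z
  exact Set.mem_add.2 ⟨l + x i, ⟨i, l, hl, rfl⟩, z - (l + x i), by simpa [unitBall] using hz,
    by abel⟩

/-- Union bound over the nets: if the expected number of bad events is less than `1`, then some
choice of `m` points modulo `Λ` gives a covering of multiplicity less than `k`. -/
theorem exists_periodicSet_isCovering (h : IsPeriod 4 Λ D) {ε δ τ K : ℝ} (hε : 0 < ε)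
    (hε1 : ε ≤ 1) (hδ : 0 < δ) (hδ1 : δ < 1) (hτ : 0 ≤ τ) (hετ : ε ^ 2 + 2 * ε * τ ≤ 1)
    (hK : 1 ≤ K) (m k : ℕ)
    (hlt : (16 / ε) ^ n * 32 ^ n * Real.exp
        ((Real.exp (-(√n * τ / 2)) * (Real.exp 3 * (2 * n + 2)) - 1) *
          (√(1 - ε ^ 2 - 2 * ε * τ) ^ n * ballRatio D)) ^ m +
      (16 / δ) ^ n * ((K ^ k)⁻¹ *
        Real.exp ((K - 1) * ((1 + δ) ^ n * ballRatio D)) ^ m) < 1) :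
    ∃ x : Fin m → Euc n, IsCovering (unitBall n) (periodicSet Λ x) Set.univ ∧
      coveringMultiplicity (unitBall n) (periodicSet Λ x) ≤ k := by
  set ρ := √(1 - ε ^ 2 - 2 * ε * τ) with hρdef
  have hρ0 : 0 ≤ ρ := Real.sqrt_nonneg _
  have hρ2 : ρ ^ 2 = 1 - ε ^ 2 - 2 * ε * τ := Real.sq_sqrt (by linarith)
  have hρ1 : ρ ≤ 1 := by
    refine abs_le_of_sq_le_sq' ?_ zero_le_one |>.2
    rw [hρ2]
    have : 0 ≤ ε ^ 2 + 2 * ε * τ := by positivity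
    linarith
  set a₁ := Real.exp ((Real.exp (-(√n * τ / 2)) * (Real.exp 3 * (2 * n + 2)) - 1) *
          (ρ ^ n * ballRatio D)) with ha₁
  set a₂ := Real.exp ((K - 1) * ((1 + δ) ^ n * ballRatio D)) with ha₂
  have ha₁0 : 0 ≤ a₁ := (Real.exp_pos _).le
  have ha₂0 : 0 ≤ a₂ := (Real.exp_pos _).le
  have hKk : 0 < K ^ k := by positivity
  obtain ⟨Y₁, hY₁, hc₁⟩ := h.exists_net hε (by linarith)
  obtain ⟨Y₂, hY₂, hc₂⟩ := h.exists_net hδ (by linarith)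
  obtain ⟨W, hWc, hW2, hW⟩ := h.exists_directions
  rw [show (4 * 4 : ℝ) = 16 by norm_num] at hc₁ hc₂
  have := h.isProbabilityMeasure_unif
  obtain ⟨x, hx⟩ := exists_sum_mul_prod_le (unif D) ((Y₁ ×ˢ W).disjSum Y₂)
    (Sum.elim (fun e => coverWeight Λ ρ τ e.1 e.2) (fun y => countWeight Λ K (1 + δ) y))
    (by
      rintro (⟨y, w⟩ | y) -
      · exact h.measurable_coverWeight ρ τ y w
      · exact h.measurable_countWeight K (1 + δ) y)
    (Sum.elim (fun _ => ENNReal.ofReal a₁) (fun _ => ENNReal.ofReal a₂))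
    (by
      rintro (⟨y, w⟩ | y) he
      · have hw := (Finset.mem_product.1 (Finset.inl_mem_disjSum.1 he)).2
        exact h.lintegral_coverWeight_le hρ0 hρ1 τ y (hW2 w hw)
      · exact h.lintegral_countWeight_le (by linarith) (by linarith) (by linarith) y)
    m (Sum.elim (fun _ => 1) (fun _ => ENNReal.ofReal (K ^ k)⁻¹))
  have hsmall : ∑ e ∈ (Y₁ ×ˢ W).disjSum Y₂,
      (Sum.elim (fun _ => 1) (fun _ => ENNReal.ofReal (K ^ k)⁻¹) e : ℝ≥0∞) *
        (Sum.elim (fun _ => ENNReal.ofReal a₁) (fun _ => ENNReal.ofReal a₂) e : ℝ≥0∞) ^ m < 1 := by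
    rw [Finset.sum_disjSum]
    simp only [Sum.elim_inl, Sum.elim_inr, Finset.sum_const, one_mul, nsmul_eq_mul,
      Finset.card_product]
    rw [← ENNReal.ofReal_pow ha₁0, ← ENNReal.ofReal_pow ha₂0, ← ENNReal.ofReal_natCast,
      ← ENNReal.ofReal_natCast, ← ENNReal.ofReal_mul (by positivity),
      ← ENNReal.ofReal_mul (by positivity), ← ENNReal.ofReal_mul (by positivity),
      ← ENNReal.ofReal_add (by positivity) (by positivity), ENNReal.ofReal_lt_one]
    refine lt_of_le_of_lt ?_ hlt
    push_cast
    gcongr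
  have hx1 := hx.trans_lt hsmall
  have hterm := fun (e : (Euc n × Euc n) ⊕ Euc n) (he : e ∈ (Y₁ ×ˢ W).disjSum Y₂) =>
    (Finset.single_le_sum (f := fun e => (Sum.elim (fun _ => 1)
      (fun _ => ENNReal.ofReal (K ^ k)⁻¹) e : ℝ≥0∞) * ∏ i, (Sum.elim
        (fun e : Euc n × Euc n => coverWeight Λ ρ τ e.1 e.2)
        (fun y => countWeight Λ K (1 + δ) y) e) (x i)) (fun _ _ => zero_le) he).trans_lt hx1
  refine ⟨x, h.isCovering_periodicSet (by norm_num) x ?_, iSup_le fun r => iSup₂_le fun z _ => ?_⟩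
  · by_contra! hcon
    obtain ⟨z, hz⟩ := hcon
    obtain ⟨y, hy, w, hw, h1⟩ := h.exists_one_le_prod_coverWeight hε hρ1 hρ2 hY₁ hW x hz
    have := hterm (Sum.inl (y, w)) (Finset.inl_mem_disjSum.2 (Finset.mem_product.2 ⟨hy, hw⟩))
    simp only [Sum.elim_inl, one_mul] at this
    exact absurd h1 (not_le.2 this)
  · obtain ⟨y, hy, j, hj, hp⟩ := h.exists_multiplicityAt_le_prod_countWeight (K := K) hδ1 hY₂ x z
    refine hj.trans ?_
    have := hterm (Sum.inr y) (Finset.inr_mem_disjSum.2 hy)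
    simp only [Sum.elim_inr, hp] at this
    rw [← ENNReal.ofReal_pow (by positivity), ← ENNReal.ofReal_mul (by positivity),
      ENNReal.ofReal_lt_one, inv_mul_lt_iff₀ hKk, mul_one] at this
    exact_mod_cast (le_of_not_gt fun hkj => absurd (pow_le_pow_right₀ hK hkj.le) (not_le.2 this))

end IsPeriod

/-! ### Asymptotics of the bounds -/

lemma tendsto_log_natCast : Tendsto (fun n : ℕ => Real.log n) atTop atTop :=
  Real.tendsto_log_atTop.comp tendsto_natCast_atTop_atTop

lemma tendsto_natCast_mul_log : Tendsto (fun n : ℕ => (n : ℝ) * Real.log n) atTop atTop :=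
  tendsto_natCast_atTop_atTop.atTop_mul_atTop₀ tendsto_log_natCast

lemma tendsto_log_log_div_log :
    Tendsto (fun n : ℕ => Real.log (Real.log n) / Real.log n) atTop (𝓝 0) :=
  Real.isLittleO_log_id_atTop.tendsto_div_nhds_zero.comp tendsto_log_natCast

lemma tendsto_const_div_log (c : ℝ) : Tendsto (fun n : ℕ => c / Real.log n) atTop (𝓝 0) :=
  tendsto_const_nhds.div_atTop tendsto_log_natCast

/-- The exponent in the bound for the covering events, divided by `n log n`, tends to
`1 / 2 - (1 / 2 + η) = -η`: the `1 / 2` comes from the net of width about `1 / √n`. -/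
lemma eventually_cover_bound {η : ℝ} (hη : 0 < η) :
    ∀ᶠ n : ℕ in atTop, ∀ ε τ Θ : ℝ, ε = 1 / (√n * Real.log n ^ 2) → τ = 4 * Real.log n / √n →
      (1 / 2 + η) * n * Real.log n - 1 ≤ Θ →
      (16 / ε) ^ n * 32 ^ n * Real.exp
        ((Real.exp (-(√n * τ / 2)) * (Real.exp 3 * (2 * n + 2)) - 1) *
          (√(1 - ε ^ 2 - 2 * ε * τ) ^ n * Θ)) ≤ 1 / 3 := by
  have hκ : Tendsto (fun n : ℕ => Real.exp 3 * (2 / n + 2 / (n : ℝ) ^ 2)) atTop (𝓝 0) := by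
    have h1 : Tendsto (fun n : ℕ => 2 / (n : ℝ)) atTop (𝓝 0) :=
      tendsto_const_nhds.div_atTop tendsto_natCast_atTop_atTop
    have h2 : Tendsto (fun n : ℕ => 2 / (n : ℝ) ^ 2) atTop (𝓝 0) :=
      tendsto_const_nhds.div_atTop
        ((tendsto_pow_atTop two_ne_zero).comp tendsto_natCast_atTop_atTop)
    simpa using (h1.add h2).const_mul (Real.exp 3)
  have hs : Tendsto (fun n : ℕ => (1 / Real.log n) ^ 4 + 8 / Real.log n) atTop (𝓝 0) := by
    simpa using ((tendsto_const_div_log 1).pow 4).add (tendsto_const_div_log 8)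
  have hN : Tendsto (fun n : ℕ => 1 / ((n : ℝ) * Real.log n)) atTop (𝓝 0) :=
    tendsto_const_nhds.div_atTop tendsto_natCast_mul_log
  have hlim : Tendsto (fun n : ℕ => ((Real.log 16 + Real.log 32) / Real.log n + 1 / 2 +
      2 * (Real.log (Real.log n) / Real.log n)) -
      (1 - Real.exp 3 * (2 / n + 2 / (n : ℝ) ^ 2)) *
        ((1 - ((1 / Real.log n) ^ 4 + 8 / Real.log n)) *
          ((1 / 2 + η) - 1 / ((n : ℝ) * Real.log n)))) atTop
      (𝓝 ((0 + 1 / 2 + 2 * 0) - (1 - 0) * ((1 - 0) * ((1 / 2 + η) - 0)))) :=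
    (((tendsto_const_div_log _).add tendsto_const_nhds).add
      (tendsto_log_log_div_log.const_mul 2)).sub
      ((tendsto_const_nhds.sub hκ).mul ((tendsto_const_nhds.sub hs).mul
        (tendsto_const_nhds.sub hN)))
  have hneg := hlim.eventually (gt_mem_nhds (show _ < -(η / 2) by linarith))
  filter_upwards [hneg, hκ.eventually (gt_mem_nhds one_pos), hs.eventually (gt_mem_nhds one_pos),
    hN.eventually (gt_mem_nhds (show 0 < 1 / 2 + η by linarith)),
    tendsto_log_natCast.eventually_gt_atTop 0, tendsto_natCast_mul_log.eventually_ge_atTop (4 / η),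
    eventually_gt_atTop 0] with n hneg hκ1 hs1 hN1 hL hbig hn ε τ Θ hε hτ hΘ
  set L := Real.log n with hLdef
  have hn0 : (0 : ℝ) < n := by exact_mod_cast hn
  have hsn : 0 < √(n : ℝ) := Real.sqrt_pos.2 hn0
  have hsn2 : √(n : ℝ) ^ 2 = n := Real.sq_sqrt hn0.le
  have e1 : Real.exp (-(√n * τ / 2)) * (Real.exp 3 * (2 * n + 2)) =
      Real.exp 3 * (2 / n + 2 / (n : ℝ) ^ 2) := by
    have : -(√n * τ / 2) = -(L + L) := by rw [hτ]; field_simp; norm_num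
    rw [this, Real.exp_neg, Real.exp_add, hLdef, Real.exp_log hn0]
    field_simp
  have e2 : ε ^ 2 + 2 * ε * τ = ((1 / L) ^ 4 + 8 / L) / n := by
    have h1 : ε ^ 2 = (1 / L) ^ 4 / n := by
      rw [hε, div_pow, mul_pow, hsn2, div_pow]; field_simp
    have h2 : 2 * ε * τ = 8 / L / √n ^ 2 := by
      rw [hε, hτ]; field_simp; norm_num
    rw [h1, h2, hsn2]; ring
  set σ := (1 / L) ^ 4 + 8 / L with hσ
  set κ := Real.exp 3 * (2 / n + 2 / (n : ℝ) ^ 2) with hκdef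
  have hσ0 : 0 ≤ σ := by positivity
  have hσn : σ / n ≤ 1 := by
    rw [div_le_one hn0]
    exact hs1.le.trans (by exact_mod_cast hn)
  have hρ : 1 - σ ≤ √(1 - ε ^ 2 - 2 * ε * τ) ^ n := by
    have h1 : 1 - ε ^ 2 - 2 * ε * τ = 1 - σ / n := by rw [← e2]; ring
    have h2 : 1 - σ / n ≤ √(1 - σ / n) := by
      refine Real.le_sqrt_of_sq_le ?_
      have : 0 ≤ σ / n := by positivity
      nlinarith
    rw [h1]
    calc 1 - σ = 1 + n * (-(σ / n)) := by field_simp; ring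
      _ ≤ (1 + -(σ / n)) ^ n := one_add_mul_le_pow (by linarith) n
      _ ≤ _ := pow_le_pow_left₀ (by linarith) (by linarith) n
  have hΘ' : n * L * ((1 / 2 + η) - 1 / (n * L)) ≤ Θ := by
    refine le_trans (le_of_eq ?_) hΘ
    field_simp
  have e3 : (16 / ε) ^ n * 32 ^ n =
      Real.exp (n * L * ((Real.log 16 + Real.log 32) / L + 1 / 2 + 2 * (Real.log L / L))) := by
    have h1 : 16 / ε = 16 * (√n * L ^ 2) := by rw [hε]; field_simp
    have h2 : Real.log (16 / ε * 32) = L * ((Real.log 16 + Real.log 32) / L + 1 / 2 +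
        2 * (Real.log L / L)) := by
      rw [h1, Real.log_mul (by positivity) (by norm_num), Real.log_mul (by norm_num)
        (by positivity), Real.log_mul (by positivity) (by positivity), Real.log_pow,
        Real.log_sqrt hn0.le, ← hLdef]
      push_cast
      field_simp
      ring
    have hε0 : 0 < ε := by rw [hε]; positivity
    rw [← mul_pow, mul_assoc, ← h2, Real.exp_nat_mul, Real.exp_log (by positivity)]
  rw [e1, e3, ← Real.exp_add]
  have hprod : n * L * ((1 - σ) * ((1 / 2 + η) - 1 / (n * L))) ≤
      √(1 - ε ^ 2 - 2 * ε * τ) ^ n * Θ := by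
    calc _ = (1 - σ) * (n * L * ((1 / 2 + η) - 1 / (n * L))) := by ring
      _ ≤ _ := mul_le_mul hρ hΘ' (mul_nonneg (by positivity) (by linarith)) (by positivity)
  have hfin : n * L * ((Real.log 16 + Real.log 32) / L + 1 / 2 + 2 * (Real.log L / L)) +
      (κ - 1) * (√(1 - ε ^ 2 - 2 * ε * τ) ^ n * Θ) ≤ -2 := by
    have h1 := mul_le_mul_of_nonneg_left hprod (show 0 ≤ 1 - κ by linarith)
    have h2 := mul_le_mul_of_nonneg_left hneg.le (show 0 ≤ n * L by positivity)
    have h3 : 2 ≤ n * L * (η / 2) := by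
      have := mul_le_mul_of_nonneg_right hbig (show 0 ≤ η / 2 by linarith)
      refine le_trans (le_of_eq ?_) this
      field_simp; norm_num
    linarith
  refine (Real.exp_le_exp.2 hfin).trans ?_
  rw [Real.exp_neg, ← one_div]
  have := Real.add_one_le_exp (2 : ℝ)
  exact one_div_le_one_div_of_le (by norm_num) (by linarith)

/-- The exponent in the bound for the multiplicity events, divided by `n log n`, tends to
`1 - (ξ + δ) log (2 ξ) + (2 ξ - 1) (1 / 2 + δ / 4)`, and the equation for `ξ` says exactly that
this vanishes for `δ = 0`. -/
lemma eventually_multiplicity_bound {ξ δ : ℝ} (hξ1 : 1 ≤ ξ) (hξ2 : ξ ≤ 2)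
    (hξ : Real.log (2 * ξ) = 1 + 1 / (2 * ξ)) (hδ : 0 < δ) :
    ∀ᶠ n : ℕ in atTop, ∀ ε Θ : ℝ, ∀ k : ℕ, ε = 1 / (n * Real.log n) →
      Θ ≤ (1 / 2 + δ / 4) * n * Real.log n → (ξ + δ) * n * Real.log n - 1 ≤ k →
      (16 / ε) ^ n * (((2 * ξ) ^ k)⁻¹ *
        Real.exp ((2 * ξ - 1) * ((1 + ε) ^ n * Θ))) ≤ 1 / 3 := by
  have hN : Tendsto (fun n : ℕ => 1 / ((n : ℝ) * Real.log n)) atTop (𝓝 0) :=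
    tendsto_const_nhds.div_atTop tendsto_natCast_mul_log
  have hlog1 : 1 ≤ Real.log (2 * ξ) := by
    rw [hξ]
    have : 0 ≤ 1 / (2 * ξ) := by positivity
    linarith
  have hexp : Tendsto (fun n : ℕ => Real.exp (1 / Real.log n)) atTop (𝓝 1) := by
    simpa [Function.comp_def] using (Real.continuous_exp.tendsto 0).comp (tendsto_const_div_log 1)
  have hlim : Tendsto (fun n : ℕ => (Real.log 16 / Real.log n + 1 +
      Real.log (Real.log n) / Real.log n) -
      ((ξ + δ) - 1 / ((n : ℝ) * Real.log n)) * Real.log (2 * ξ) +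
      (2 * ξ - 1) * (Real.exp (1 / Real.log n) * (1 / 2 + δ / 4))) atTop
      (𝓝 ((0 + 1 + 0) - ((ξ + δ) - 0) * Real.log (2 * ξ) +
        (2 * ξ - 1) * (1 * (1 / 2 + δ / 4)))) :=
    ((((tendsto_const_div_log _).add tendsto_const_nhds).add tendsto_log_log_div_log).sub
      ((tendsto_const_nhds.sub hN).mul_const _)).add
      ((hexp.mul_const _).const_mul _)
  have hval : (0 + 1 + 0) - ((ξ + δ) - 0) * Real.log (2 * ξ) +
        (2 * ξ - 1) * (1 * (1 / 2 + δ / 4)) < -(δ / 8) := by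
    have h1 : ξ * Real.log (2 * ξ) = ξ + 1 / 2 := by rw [hξ]; field_simp
    nlinarith
  filter_upwards [hlim.eventually (gt_mem_nhds hval),
    tendsto_log_natCast.eventually_gt_atTop 0,
    tendsto_natCast_mul_log.eventually_ge_atTop (16 / δ),
    eventually_gt_atTop 0] with n hneg hL hbig hn ε Θ k hε hΘ hk
  set L := Real.log n with hLdef
  have hn0 : (0 : ℝ) < n := by exact_mod_cast hn
  have hε0 : 0 < ε := by rw [hε]; positivity
  have e1 : (16 / ε) ^ n = Real.exp (n * L * (Real.log 16 / L + 1 + Real.log L / L)) := by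
    have h1 : 16 / ε = 16 * (n * L) := by rw [hε]; field_simp
    have h2 : Real.log (16 / ε) = L * (Real.log 16 / L + 1 + Real.log L / L) := by
      rw [h1, Real.log_mul (by norm_num) (by positivity), Real.log_mul (by positivity)
        (by positivity), ← hLdef]
      field_simp
      ring
    rw [mul_assoc, ← h2, Real.exp_nat_mul, Real.exp_log (by positivity)]
  have e2 : ((2 * ξ) ^ k)⁻¹ = Real.exp (-(k * Real.log (2 * ξ))) := by
    rw [Real.exp_neg, Real.exp_nat_mul, Real.exp_log (by positivity)]
  have h1 : (1 + ε) ^ n ≤ Real.exp (1 / L) := by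
    calc (1 + ε) ^ n ≤ Real.exp ε ^ n := by
          refine pow_le_pow_left₀ (by positivity) ?_ n
          rw [add_comm]; exact Real.add_one_le_exp ε
      _ = Real.exp (n * ε) := (Real.exp_nat_mul _ _).symm
      _ = _ := by rw [hε]; congr 1; field_simp
  rw [e1, e2, ← Real.exp_add, ← Real.exp_add]
  have h2 : (1 + ε) ^ n * Θ ≤ n * L * (Real.exp (1 / L) * (1 / 2 + δ / 4)) := by
    calc (1 + ε) ^ n * Θ ≤ (1 + ε) ^ n * ((1 / 2 + δ / 4) * n * L) := by gcongr
      _ ≤ Real.exp (1 / L) * ((1 / 2 + δ / 4) * n * L) := by gcongr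
      _ = _ := by ring
  have h3 : n * L * ((ξ + δ) - 1 / (n * L)) ≤ k := by
    refine le_trans (le_of_eq ?_) hk
    field_simp
  have h4 := mul_le_mul_of_nonneg_right h3 (zero_le_one.trans hlog1)
  have h5 := mul_le_mul_of_nonneg_left h2 (show 0 ≤ 2 * ξ - 1 by linarith)
  have h6 := mul_le_mul_of_nonneg_left hneg.le (show 0 ≤ n * L by positivity)
  have h7 : 2 ≤ n * L * (δ / 8) := by
    have := mul_le_mul_of_nonneg_right hbig (show 0 ≤ δ / 8 by linarith)
    refine le_trans (le_of_eq ?_) this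
    field_simp; norm_num
  have hfin : n * L * (Real.log 16 / L + 1 + Real.log L / L) +
      (-(k * Real.log (2 * ξ)) + (2 * ξ - 1) * ((1 + ε) ^ n * Θ)) ≤ -2 := by linarith
  refine (Real.exp_le_exp.2 hfin).trans ?_
  rw [Real.exp_neg, ← one_div]
  have := Real.add_one_le_exp (2 : ℝ)
  exact one_div_le_one_div_of_le (by norm_num) (by linarith)

/-! ### The root of the equation -/

lemma log_two_mul_div_exp_one {x : ℝ} (hx : 0 < x) :
    Real.log (2 * x / Real.exp 1) = Real.log (2 * x) - 1 := by
  rw [Real.log_div (by positivity) (Real.exp_pos 1).ne', Real.log_exp]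

lemma strictMonoOn_log_sub : StrictMonoOn (fun x : ℝ => Real.log (2 * x) - 1 - 1 / (2 * x))
    (Set.Ioi 0) := by
  intro x hx y _ hxy
  rw [Set.mem_Ioi] at hx
  have h1 : Real.log (2 * x) < Real.log (2 * y) := Real.log_lt_log (by linarith) (by linarith)
  have h2 : 1 / (2 * y) < 1 / (2 * x) := one_div_lt_one_div_of_lt (by linarith) (by linarith)
  simp only
  linarith

/-- The left-hand side is about `-5.3e-7`, which dictates the precision of the bounds for `exp`. -/
lemma log_le_at_lower : Real.log (2 * 1.79556) - 1 - 1 / (2 * 1.79556) ≤ 0 := by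
  have h1 : (2 * 1.79556 : ℝ) ≤ Real.exp (1 + 1 / (2 * 1.79556)) := by
    have h2 := Real.sum_le_exp_of_nonneg (x := 1 / (2 * 1.79556)) (by norm_num) 9
    rw [Real.exp_add]
    calc (2 * 1.79556 : ℝ)
        ≤ 2.7182818283 * ∑ i ∈ Finset.range 9, (1 / (2 * 1.79556) : ℝ) ^ i / (i.factorial : ℝ) := by
          norm_num [Finset.sum_range_succ, Nat.factorial]
      _ ≤ _ := mul_le_mul Real.exp_one_gt_d9.le h2 (Finset.sum_nonneg fun i _ => by positivity)
          (Real.exp_pos 1).le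
  have := (Real.log_le_iff_le_exp (by norm_num)).2 h1
  linarith

lemma log_pos_at_upper : 0 < Real.log (2 * 1.79557) - 1 - 1 / (2 * 1.79557) := by
  have h1 : Real.exp (1 + 1 / (2 * 1.79557)) < (2 * 1.79557 : ℝ) := by
    have h2 := Real.exp_bound' (x := 1 / (2 * 1.79557)) (by norm_num) (by norm_num)
      (n := 9) (by norm_num)
    rw [Real.exp_add]
    calc _ ≤ (2.7182818286 : ℝ) * _ := mul_le_mul Real.exp_one_lt_d9.le h2 (Real.exp_pos _).le
          (by norm_num)
      _ < _ := by norm_num [Finset.sum_range_succ, Nat.factorial]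
  have := (Real.lt_log_iff_exp_lt (by norm_num)).2 h1
  linarith

lemma exists_root :
    ∃ ξ : ℝ, 1.79556 ≤ ξ ∧ ξ < 1.79557 ∧ Real.log (2 * ξ) - 1 - 1 / (2 * ξ) = 0 := by
  have hcont : ContinuousOn (fun x : ℝ => Real.log (2 * x) - 1 - 1 / (2 * x))
      (Set.Icc 1.79556 1.79557) := by
    intro x hx
    have : 2 * x ≠ 0 := by linarith [hx.1]
    exact ContinuousAt.continuousWithinAt (by fun_prop (disch := assumption))
  obtain ⟨ξ, ⟨h1, h2⟩, h⟩ := intermediate_value_Ico (by norm_num) hcont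
    ⟨log_le_at_lower, log_pos_at_upper⟩
  exact ⟨ξ, h1, h2, h⟩

/-! ### Existence of good coverings -/

/-- A unit ball covering of `ℝⁿ` with density at most `(1 / 2 + δ) n log n` and multiplicity at
most `(ξ + δ) n log n`. -/
def HasCovering (ξ : ℝ) (n : ℕ) (δ : ℝ) : Prop :=
  ∃ P : Set (EuclideanSpace ℝ (Fin n)),
    IsCovering (unitBall n) P Set.univ ∧
    coveringDensity (unitBall n) P ≤ ENNReal.ofReal ((1 / 2 + δ) * n * Real.log n) ∧
    (coveringMultiplicity (unitBall n) P : ℝ≥0∞) ≤ ENNReal.ofReal ((ξ + δ) * n * Real.log n)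

lemma IsPeriod.volume_div_eq {n : ℕ} {d : ℝ} {Λ : Submodule ℤ (Euc n)} {D : Set (Euc n)}
    (h : IsPeriod d Λ D) :
    volume (unitBall n) / volume D = ENNReal.ofReal (IsPeriod.ballRatio D) := by
  have hD : 0 < volume.real D := ENNReal.toReal_pos h.volume_ne_zero h.volume_ne_top
  rw [IsPeriod.ballRatio, ENNReal.ofReal_div_of_pos hD, ofReal_measureReal h.volume_ne_top,
    ofReal_measureReal (IsPeriod.volume_unitBall_ne_top n)]

lemma IsPeriod.ballRatio_pos {n : ℕ} {d : ℝ} {Λ : Submodule ℤ (Euc n)} {D : Set (Euc n)}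
    (h : IsPeriod d Λ D) : 0 < IsPeriod.ballRatio D :=
  div_pos (ENNReal.toReal_pos (IsPeriod.volume_unitBall_ne_zero n)
    (IsPeriod.volume_unitBall_ne_top n)) (ENNReal.toReal_pos h.volume_ne_zero h.volume_ne_top)

lemma IsPeriod.ballRatio_le_one {n : ℕ} {Λ : Submodule ℤ (Euc n)} {D : Set (Euc n)}
    (h : IsPeriod 4 Λ D) : IsPeriod.ballRatio D ≤ 1 :=
  div_le_one_of_le₀ (ENNReal.toReal_mono h.volume_ne_top (h.volume_unitBall_le (by norm_num)))
    measureReal_nonneg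

/-- In a fixed dimension, a finite net modulo a lattice has finite density and multiplicity. -/
lemma exists_hasCovering {ξ : ℝ} (hξ : 0 ≤ ξ) {n : ℕ} (hn : 2 ≤ n) :
    ∃ δ : ℝ, 0 < δ ∧ HasCovering ξ n δ := by
  obtain ⟨Λ, D, h⟩ := exists_isPeriod n (d := 4) (by norm_num)
  obtain ⟨Y, hY, -⟩ := h.exists_net one_pos (by norm_num)
  have hcov := h.isCovering_periodicSet (by norm_num) (fun y : Y => (y : Euc n)) fun z => by
    obtain ⟨y, hy, l, hl, hz⟩ := hY z
    exact ⟨⟨y, hy⟩, l, hl, hz⟩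
  have hL : 1 / 2 ≤ Real.log n := by
    have h1 : Real.log 2 ≤ Real.log n := Real.log_le_log (by norm_num) (by exact_mod_cast hn)
    linarith [Real.log_two_gt_d9]
  have hn2 : (2 : ℝ) ≤ n := by exact_mod_cast hn
  have hN : 1 ≤ (n : ℝ) * Real.log n := by nlinarith
  have hbound : ∀ c : ℝ, 0 ≤ c → (Y.card : ℝ) ≤ (c + (Y.card + 1)) * n * Real.log n := by
    intro c hc
    rw [mul_assoc]
    have : (0 : ℝ) ≤ Y.card := Nat.cast_nonneg _
    nlinarith
  refine ⟨Y.card + 1, by positivity, _, hcov, ?_, ?_⟩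
  · refine (h.coveringDensity_le _).trans ?_
    rw [h.volume_div_eq, Fintype.card_coe, ← ENNReal.ofReal_natCast,
      ← ENNReal.ofReal_mul (by positivity)]
    refine ENNReal.ofReal_le_ofReal (le_trans ?_ (hbound _ (by norm_num)))
    exact mul_le_of_le_one_right (Nat.cast_nonneg _) h.ballRatio_le_one
  · have hm : coveringMultiplicity (unitBall n) (periodicSet Λ fun y : Y => (y : Euc n)) ≤
        (Y.card : ℕ∞) := by
      refine iSup_le fun r => iSup₂_le fun z _ => ?_
      simpa using h.coveringMultiplicityAt_le (by norm_num) (fun y : Y => (y : Euc n)) z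
        Finset.univ (by simp)
    have hm' : (coveringMultiplicity (unitBall n) (periodicSet Λ fun y : Y => (y : Euc n)) :
        ℝ≥0∞) ≤ ((Y.card : ℕ∞) : ℝ≥0∞) := ENat.toENNReal_le.2 hm
    refine hm'.trans ?_
    rw [ENat.toENNReal_coe, ← ENNReal.ofReal_natCast]
    exact ENNReal.ofReal_le_ofReal (hbound ξ hξ)

/-- The number `m` of points per period is chosen so that the density is `(1 / 2 + δ / 4) n log n`
up to rounding. The slack between `δ / 4` and `δ` pays for the multiplicity. -/
theorem eventually_hasCovering {ξ : ℝ} (hξ1 : 1 ≤ ξ) (hξ2 : ξ ≤ 2)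
    (hξ : Real.log (2 * ξ) = 1 + 1 / (2 * ξ)) {δ : ℝ} (hδ : 0 < δ) :
    ∀ᶠ n : ℕ in atTop, HasCovering ξ n δ := by
  have h8 := (tendsto_const_div_log 8).eventually (gt_mem_nhds (show (0 : ℝ) < 1 / 2 by norm_num))
  filter_upwards [eventually_cover_bound (η := δ / 4) (by positivity),
    eventually_multiplicity_bound hξ1 hξ2 hξ hδ,
    tendsto_log_natCast.eventually_ge_atTop 2, h8,
    eventually_gt_atTop 0] with n hcov hmult hL h8 hn
  obtain ⟨Λ, D, h⟩ := exists_isPeriod n (d := 4) (by norm_num)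
  set L := Real.log n with hLdef
  set β := IsPeriod.ballRatio D with hβ
  have hβ0 : 0 < β := h.ballRatio_pos
  have hβ1 : β ≤ 1 := h.ballRatio_le_one
  have hn1 : (1 : ℝ) ≤ n := by exact_mod_cast hn
  have hsn : 1 ≤ √(n : ℝ) := Real.one_le_sqrt.2 hn1
  have hsn2 : √(n : ℝ) ^ 2 = n := Real.sq_sqrt (by linarith)
  have hL0 : 0 < L := by linarith
  set m := ⌊(1 / 2 + δ / 4) * n * L / β⌋₊ with hm
  set k := ⌊(ξ + δ) * n * L⌋₊ with hk
  have hm1 : m * β ≤ (1 / 2 + δ / 4) * n * L :=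
    (le_div_iff₀ hβ0).1 (Nat.floor_le (by positivity))
  have hm2 : (1 / 2 + δ / 4) * n * L - 1 ≤ m * β := by
    have := (div_le_iff₀ hβ0).1 (Nat.lt_floor_add_one ((1 / 2 + δ / 4) * n * L / β)).le
    rw [← hm, add_mul] at this
    linarith
  have hk1 : (ξ + δ) * n * L - 1 ≤ k := by
    linarith [Nat.lt_floor_add_one ((ξ + δ) * n * L)]
  have hk2 : (k : ℝ) ≤ (ξ + δ) * n * L := Nat.floor_le (by positivity)
  set ε := 1 / (√n * L ^ 2) with hε
  set τ := 4 * L / √n with hτ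
  set ε' := 1 / (n * L) with hε'
  have hε0 : 0 < ε := by positivity
  have hL2 : 4 ≤ L ^ 2 := by nlinarith
  have hε1 : ε ≤ 1 / 2 := by
    refine one_div_le_one_div_of_le (by norm_num) ?_
    nlinarith
  have hετ : 2 * ε * τ ≤ 1 / 2 := by
    have e : 2 * ε * τ = 8 / L / √n ^ 2 := by
      rw [hε, hτ]; field_simp; norm_num
    rw [e, hsn2]
    exact (div_le_self (by positivity) hn1).trans h8.le
  have hε'0 : 0 < ε' := by positivity
  have hε'1 : ε' < 1 := by
    rw [hε', div_lt_one (by positivity)]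
    nlinarith
  have hpow : ∀ a b : ℝ, Real.exp (a * (b * β)) ^ m = Real.exp (a * (b * (m * β))) := by
    intro a b
    rw [← Real.exp_nat_mul]
    congr 1; ring
  obtain ⟨x, hx, hxm⟩ := h.exists_periodicSet_isCovering (K := 2 * ξ) hε0 (by linarith) hε'0 hε'1
    (show 0 ≤ τ by positivity) (by nlinarith) (by linarith) m k (by
      rw [hpow, hpow]
      have h1 := hcov ε τ (m * β) hε hτ hm2
      have h2 := hmult ε' (m * β) k hε' hm1 hk1
      linarith)
  refine ⟨_, hx, ?_, ?_⟩
  · refine (h.coveringDensity_le x).trans ?_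
    rw [h.volume_div_eq, Fintype.card_fin, ← ENNReal.ofReal_natCast,
      ← ENNReal.ofReal_mul (by positivity)]
    refine ENNReal.ofReal_le_ofReal (hm1.trans ?_)
    gcongr
    linarith
  · have hm' : (coveringMultiplicity (unitBall n) (periodicSet Λ x) : ℝ≥0∞) ≤
        ((k : ℕ∞) : ℝ≥0∞) := ENat.toENNReal_le.2 hxm
    refine hm'.trans ?_
    rw [ENat.toENNReal_coe, ← ENNReal.ofReal_natCast]
    exact ENNReal.ofReal_le_ofReal hk2

/-- If every positive error is eventually admissible, then near-optimal admissible errors tend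
to zero. -/
lemma exists_tendsto_zero_of_eventually {G : ℕ → ℝ → Prop} {N : ℕ}
    (h1 : ∀ δ > 0, ∀ᶠ n in atTop, G n δ) (h2 : ∀ n, N ≤ n → ∃ δ > 0, G n δ) :
    ∃ ε : ℕ → ℝ, Tendsto ε atTop (𝓝 0) ∧ ∀ n, N ≤ n → G n (ε n) := by
  have hex : ∀ n, ∃ δ, N ≤ n → 0 < δ ∧ G n δ ∧ δ < sInf {δ | 0 < δ ∧ G n δ} + 1 / (n + 1) := by
    intro n
    by_cases hn : N ≤ n
    · obtain ⟨δ, hδ, hlt⟩ := exists_lt_of_csInf_lt (s := {δ | 0 < δ ∧ G n δ}) (h2 n hn)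
        (lt_add_of_pos_right _ (show (0 : ℝ) < 1 / (n + 1) by positivity))
      exact ⟨δ, fun _ => ⟨hδ.1, hδ.2, hlt⟩⟩
    · exact ⟨0, fun h => absurd h hn⟩
  choose ε hε using hex
  refine ⟨ε, ?_, fun n hn => (hε n hn).2.1⟩
  rw [NormedAddGroup.tendsto_nhds_zero]
  intro η hη
  have hlim : Tendsto (fun n : ℕ => 1 / ((n : ℝ) + 1)) atTop (𝓝 0) :=
    tendsto_one_div_add_atTop_nhds_zero_nat
  filter_upwards [h1 (η / 2) (by positivity),
    hlim.eventually (gt_mem_nhds (show 0 < η / 2 by positivity)), eventually_ge_atTop N]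
    with n hG hsmall hn
  obtain ⟨hpos, -, hlt⟩ := hε n hn
  have hinf : sInf {δ | 0 < δ ∧ G n δ} ≤ η / 2 :=
    csInf_le ⟨0, fun δ hδ => hδ.1.le⟩ ⟨by positivity, hG⟩
  rw [Real.norm_of_nonneg hpos.le]
  linarith

theorem theorem1 :
    ∃ ξ : ℝ,
      (0 < ξ ∧ Real.log (2 * ξ / Real.exp 1) = 1 / (2 * ξ)) ∧
      (∀ y : ℝ, 0 < y → Real.log (2 * y / Real.exp 1) = 1 / (2 * y) → y = ξ) ∧
      (1.79556 ≤ ξ ∧ ξ < 1.79557) ∧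
      ∃ ε₁ ε₂ : ℕ → ℝ,
        Tendsto ε₁ atTop (𝓝 0) ∧ Tendsto ε₂ atTop (𝓝 0) ∧
        ∀ n : ℕ, 2 ≤ n →
          ∃ P : Set (EuclideanSpace ℝ (Fin n)),
            IsCovering (unitBall n) P Set.univ ∧
            coveringDensity (unitBall n) P
              ≤ ENNReal.ofReal ((1 / 2 + ε₁ n) * n * Real.log n) ∧
            (coveringMultiplicity (unitBall n) P : ℝ≥0∞)
              ≤ ENNReal.ofReal ((ξ + ε₂ n) * n * Real.log n) := by
  obtain ⟨ξ, h1, h2, h⟩ := exists_root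
  have h0 : 0 < ξ := by linarith
  obtain ⟨ε, hε, hcov⟩ := exists_tendsto_zero_of_eventually (G := HasCovering ξ) (N := 2)
    (fun δ hδ => eventually_hasCovering (by linarith) (by linarith) (by linarith) hδ)
    (fun n hn => exists_hasCovering h0.le hn)
  refine ⟨ξ, ⟨h0, ?_⟩, fun y hy hyeq => ?_, ⟨h1, h2⟩, ε, ε, hε, hε, hcov⟩
  · rw [log_two_mul_div_exp_one h0]
    linarith
  · rw [log_two_mul_div_exp_one hy] at hyeq
    refine strictMonoOn_log_sub.injOn hy h0 ?_
    linarith
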